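/- Let $\mathbf F=\mathbf R$ or $\mathbf C$, let $M$ be a Hausdorff manifold modelled on $\mathbf F^n$ (of class $C^\infty$ if $\mathbf F=\mathbf R$, complex analytic if $\mathbf F=\mathbf C$), and let $p\in M$. The classical blowup of $M$ at $p$ is the manifold $\widehat M=(M\setminus\{p\})\sqcup \mathbf P(T_pM)$ with blowdown map $q\colon\widehat M\to M$ (the identity on $M\setminus\{p\}$, and constantly $p$ on $\Sigma:=\mathbf P(T_pM)=q^{-1}(p)$). Its charts are the charts of $M\setminus\{p\}$ together with the following: in a coordinate system $x=(x_1,\dots,x_n)$ of $M$ at $p$ with $x(p)=0$, for $1\le i\le n$, the coordinates $x_i$ and $x_j/x_i$ ($j\ne i$) at the points off $\Sigma$ near $p$ with $x_i\neq 0$, and the coordinates $0$ and $v_j/v_i$ ($j\ne i$) at the points $[v]\in\Sigma$ with $v_i\ne 0$. For a diffeomorphism $h$ of $M$ with $h(p)=p$ (holomorphic if $\mathbf F=\mathbf C$) let $\widehat h\colon\widehat M\to\widehat M$ be given by $\widehat h(x)=h(x)$ for $x\in M\setminus\{p\}$ and $\widehat h([v])=[Dh|_p(v)]$ for $[v]\in\Sigma$.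 For a manifold $X$ and $A\subset X$, $\operatorname{Aut}_{C^k}(X,A)$ is the group of $C^k$ diffeomorphisms $f$ of $X$ with $f(A)=A$ (homeomorphisms if $k=0$), with the $C^k$ compact-open topology (uniform convergence on compact sets, in charts, of all derivatives of finite order at most $k$); $\operatorname{Aut}_{\rm Holo}(X,A)$ is the group of biholomorphisms $f$ of $X$ with $f(A)=A$, with the compact-open topology. (1) Let $\mathbf F=\mathbf R$ and $k\in\{1,2,\dots\}\cup\{\infty\}$ (with $\infty-1=\infty$). Then $h\mapsto\widehat h$ is a continuous, injective group homomorphism $$\beta\colon\operatorname{Aut}_{C^k}(M,\{p\})\to\operatorname{Aut}_{C^{k-1}}(\widehat M,\Sigma).$$ Moreover, each $\widehat h$ is of class $C^k$ at every point of $\widehat M\setminus\Sigma$. (2) Let $\mathbf F=\mathbf C$. Then $h\mapsto\widehat h$ is a continuous, injective group homomorphism $$\beta\colon\operatorname{Aut}_{\rm Holo}(M,\{p\})\to\operatorname{Aut}_{\rm Holo}(\widehat M,\Sigma).$$ (3) The loss of one derivative along $\Sigma$ in (1) is genuine: for every integer $k\ge1$ there is $h\in\operatorname{Aut}_{C^k}(\mathbf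 R^2,\{0\})$ such that $\widehat h$ is not of class $C^k$ at some point of $\Sigma$. (4) Explicitly, $h(x,y)=(x+x|x|,\,y)$ belongs to $\operatorname{Aut}_{C^1}(\mathbf R^2,\{0\})$, and for every real $m\neq0$ there is a $C^\infty$ curve $c\colon\mathbf R\to\widehat{\mathbf R^2}$ with $q(c(t))=(t,mt)$ for all $t$ and $c(0)=[1,m]\in\Sigma$, such that $\widehat h\circ c$ is continuous but not differentiable at $t=0$; hence $\widehat h$ is not differentiable at $[1,m]$. -/

import Mathlib

open Set Topology
open scoped Manifold ContDiff LinearAlgebra.Projectivization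

namespace ClassicalBlowup

/-- The coordinate space `𝔽ⁿ`. -/
abbrev Coord (𝕜 : Type) [RCLike 𝕜] (n : ℕ) : Type := EuclideanSpace 𝕜 (Fin n)

section Algebra

variable {𝕜 : Type} [RCLike 𝕜] {n : ℕ}

/-- The vector obtained from `u` by replacing its `i`-th coordinate by `1`. -/
noncomputable def dir (i : Fin n) (u : Coord 𝕜 n) : Coord 𝕜 n :=
  WithLp.toLp 2 (fun j => if j = i then 1 else u j)

/-- The coordinates `v_i` and `v_j / v_i` (`j ≠ i`) of the point `(v, [v])` of the model blowup. -/
noncomputable def affineCoord (i : Fin n) (v : Coord 𝕜 n) : Coord 𝕜 n :=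
  WithLp.toLp 2 (fun j => if j = i then v i else v j / v i)

/-- The coordinates `0` and `L_j / L_i` (`j ≠ i`) of the point `(0, L)` of the model blowup. -/
noncomputable def lineCoord (i : Fin n) (L : ℙ 𝕜 (Coord 𝕜 n)) : Coord 𝕜 n :=
  WithLp.toLp 2 (fun j => if j = i then 0 else L.rep j / L.rep i)

@[simp] theorem dir_apply (i j : Fin n) (u : Coord 𝕜 n) :
    dir i u j = if j = i then 1 else u j := rfl

@[simp] theorem affineCoord_apply (i j : Fin n) (u : Coord 𝕜 n) :
    affineCoord i u j = if j = i then u i else u j / u i := rfl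

@[simp] theorem lineCoord_apply (i j : Fin n) (L : ℙ 𝕜 (Coord 𝕜 n)) :
    lineCoord i L j = if j = i then 0 else L.rep j / L.rep i := rfl

theorem dir_ne_zero (i : Fin n) (u : Coord 𝕜 n) : dir i u ≠ 0 := by
  intro h
  have := congrArg (fun v : Coord 𝕜 n => v i) h
  simp at this

theorem smul_dir_affineCoord (i : Fin n) (v : Coord 𝕜 n) (h : v i ≠ 0) :
    affineCoord i v i • dir i (affineCoord i v) = v := by
  ext j
  by_cases hj : j = i
  · subst hj; simp
  · simp [hj]; field_simp

theorem affineCoord_smul_dir (i : Fin n) (u : Coord 𝕜 n) (h : u i ≠ 0) :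
    affineCoord i (u i • dir i u) = u := by
  ext j
  by_cases hj : j = i
  · subst hj; simp
  · simp [hj]; field_simp

theorem exists_rep_mk (v : Coord 𝕜 n) (hv : v ≠ 0) :
    ∃ a : 𝕜, a ≠ 0 ∧ ∀ j, (Projectivization.mk 𝕜 v hv).rep j = a * v j := by
  obtain ⟨a, ha⟩ := Projectivization.exists_smul_eq_mk_rep 𝕜 v hv
  refine ⟨a, a.ne_zero, fun j => ?_⟩
  rw [← ha]; rfl

theorem exists_rep_ne_zero (L : ℙ 𝕜 (Coord 𝕜 n)) : ∃ i, L.rep i ≠ 0 := by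
  by_contra! h
  exact L.rep_nonzero (by ext j; simpa using h j)

theorem lineCoord_mk (i : Fin n) (v : Coord 𝕜 n) (hv : v ≠ 0) (j : Fin n) :
    lineCoord i (Projectivization.mk 𝕜 v hv) j = if j = i then 0 else v j / v i := by
  obtain ⟨a, ha, h⟩ := exists_rep_mk v hv
  simp only [lineCoord_apply, h]
  split_ifs
  · rfl
  · rw [mul_div_mul_left _ _ ha]

theorem mk_dir_lineCoord (i : Fin n) (L : ℙ 𝕜 (Coord 𝕜 n)) (h : L.rep i ≠ 0) :
    Projectivization.mk 𝕜 (dir i (lineCoord i L)) (dir_ne_zero i _) = L := by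
  conv_rhs => rw [← L.mk_rep]
  rw [Projectivization.mk_eq_mk_iff']
  refine ⟨(L.rep i)⁻¹, ?_⟩
  ext j
  by_cases hj : j = i
  · subst hj; simp [h]
  · simp [hj]; field_simp

end Algebra

/-- The underlying set of the blowup `M̂` of `M` at `p`: the point `p` is replaced by the projective
space of lines in the tangent space at `p`, which Mathlib identifies with `𝔽ⁿ` by means of the
preferred chart at `p`. -/
inductive Blowup (𝕜 : Type) [RCLike 𝕜] (n : ℕ) {M : Type*} [TopologicalSpace M]
    [ChartedSpace (Coord 𝕜 n) M] (p : M) : Type _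
  | off (x : M) (hx : x ≠ p) : Blowup 𝕜 n p
  | exc (L : ℙ 𝕜 (Coord 𝕜 n)) : Blowup 𝕜 n p

section Construction

variable {𝕜 : Type} [RCLike 𝕜] {n : ℕ} {M : Type*} [TopologicalSpace M]
  [ChartedSpace (Coord 𝕜 n) M]

/-- The blowdown map `q : M̂ → M`. -/
def blowdown {p : M} : Blowup 𝕜 n p → M
  | .off x _ => x
  | .exc _ => p

/-- The exceptional locus `Σ = q⁻¹(p)`. -/
def exceptionalLocus (𝕜 : Type) [RCLike 𝕜] (n : ℕ) {M : Type*} [TopologicalSpace M]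
    [ChartedSpace (Coord 𝕜 n) M] (p : M) : Set (Blowup 𝕜 n p) :=
  blowdown ⁻¹' {p}

/-- The preferred chart of `M` at `p`, as a partial equivalence, recentred so that `p` is sent
to `0`. -/
noncomputable def centred (𝕜 : Type) [RCLike 𝕜] (n : ℕ) {M : Type*} [TopologicalSpace M]
    [ChartedSpace (Coord 𝕜 n) M] (p x : M) : Coord 𝕜 n :=
  chartAt (Coord 𝕜 n) p x - chartAt (Coord 𝕜 n) p p

/-- The point of `M` with centred coordinate `v`. -/
noncomputable def uncentred (𝕜 : Type) [RCLike 𝕜] (n : ℕ) {M : Type*} [TopologicalSpace M]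
    [ChartedSpace (Coord 𝕜 n) M] (p : M) (v : Coord 𝕜 n) : M :=
  (chartAt (Coord 𝕜 n) p).symm (chartAt (Coord 𝕜 n) p p + v)

/-- The open set of centred coordinates of points near `p`. -/
def centredTarget (𝕜 : Type) [RCLike 𝕜] (n : ℕ) {M : Type*} [TopologicalSpace M]
    [ChartedSpace (Coord 𝕜 n) M] (p : M) : Set (Coord 𝕜 n) :=
  {v | chartAt (Coord 𝕜 n) p p + v ∈ (chartAt (Coord 𝕜 n) p).target}

theorem uncentred_zero (p : M) : uncentred 𝕜 n p 0 = p := by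
  simp [uncentred]

theorem uncentred_centred (p x : M) (hx : x ∈ (chartAt (Coord 𝕜 n) p).source) :
    uncentred 𝕜 n p (centred 𝕜 n p x) = x := by
  simp [uncentred, centred, hx]

theorem centred_mem (p x : M) (hx : x ∈ (chartAt (Coord 𝕜 n) p).source) :
    centred 𝕜 n p x ∈ centredTarget 𝕜 n p := by
  simp [centredTarget, centred, hx]

theorem centred_uncentred (p : M) (v : Coord 𝕜 n) (hv : v ∈ centredTarget 𝕜 n p) :
    centred 𝕜 n p (uncentred 𝕜 n p v) = v := by
  simp [uncentred, centred, (chartAt (Coord 𝕜 n) p).right_inv hv]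

theorem uncentred_mem (p : M) (v : Coord 𝕜 n) (hv : v ∈ centredTarget 𝕜 n p) :
    uncentred 𝕜 n p v ∈ (chartAt (Coord 𝕜 n) p).source :=
  (chartAt (Coord 𝕜 n) p).map_target hv

theorem uncentred_eq_iff (p : M) (v : Coord 𝕜 n) (hv : v ∈ centredTarget 𝕜 n p) :
    uncentred 𝕜 n p v = p ↔ v = 0 := by
  constructor
  · intro h
    rw [← centred_uncentred p v hv, h]; simp [centred]
  · rintro rfl; exact uncentred_zero p

theorem smul_dir_eq_zero (i : Fin n) (u : Coord 𝕜 n) : u i • dir i u = 0 ↔ u i = 0 := by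
  simp [dir_ne_zero]

theorem off_congr {p x y : M} (h : x = y) (hx : x ≠ p) (hy : y ≠ p) :
    (Blowup.off x hx : Blowup 𝕜 n p) = .off y hy := by
  subst h; rfl

open Classical in
/-- A chart `e` of `M`, restricted to `M \ {p}` and transported to `M̂ \ Σ`. The point `z₀` only
serves as a default value outside of the target. -/
noncomputable def offChart {p : M} (z₀ : Blowup 𝕜 n p)
    (e : OpenPartialHomeomorph M (Coord 𝕜 n)) :
    PartialEquiv (Blowup 𝕜 n p) (Coord 𝕜 n) where
  toFun z := e (blowdown z)
  invFun u := if h : e.symm u = p then z₀ else .off (e.symm u) h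
  source := {z | blowdown z ≠ p ∧ blowdown z ∈ e.source}
  target := {u | u ∈ e.target ∧ e.symm u ≠ p}
  map_source' z hz := ⟨e.map_source hz.2, by rw [e.left_inv hz.2]; exact hz.1⟩
  map_target' u hu := by
    simp only [hu.2, dite_false, mem_ofPred_eq, blowdown]
    exact ⟨hu.2, e.map_target hu.1⟩
  left_inv' z hz := by
    have h1 : e.symm (e (blowdown z)) = blowdown z := e.left_inv hz.2
    have h2 : e.symm (e (blowdown z)) ≠ p := by rw [h1]; exact hz.1
    simp only [h2, dite_false]
    cases z with
    | off x hx => exact off_congr h1 _ _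
    | exc L => exact absurd rfl hz.1
  right_inv' u hu := by
    simp only [hu.2, dite_false, blowdown]
    exact e.right_inv hu.1

open Classical in
/-- The `i`-th affine chart of `M̂` near `Σ`. In terms of the preferred chart of `M` at `p`,
recentred at `p`, it sends `(v, [v])` to the coordinates `v_i` and `v_j / v_i` (`j ≠ i`), and
`(0, [w])` to the coordinates `0` and `w_j / w_i` (`j ≠ i`). -/
noncomputable def excChart (p : M) (i : Fin n) :
    PartialEquiv (Blowup 𝕜 n p) (Coord 𝕜 n) where
  toFun z := match z with
    | .off x _ => affineCoord i (centred 𝕜 n p x)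
    | .exc L => lineCoord i L
  invFun u :=
    if h : uncentred 𝕜 n p (u i • dir i u) = p then
      .exc (Projectivization.mk 𝕜 (dir i u) (dir_ne_zero i u))
    else .off (uncentred 𝕜 n p (u i • dir i u)) h
  source := {z | match z with
    | .off x _ => x ∈ (chartAt (Coord 𝕜 n) p).source ∧ centred 𝕜 n p x i ≠ 0
    | .exc L => L.rep i ≠ 0}
  target := {u | u i • dir i u ∈ centredTarget 𝕜 n p}
  map_source' z hz := by
    cases z with
    | off x hx =>
      change _ ∈ centredTarget 𝕜 n p
      rw [smul_dir_affineCoord i _ hz.2]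
      exact centred_mem p x hz.1
    | exc L =>
      change _ ∈ centredTarget 𝕜 n p
      simp [centredTarget, lineCoord_apply]
  map_target' u hu := by
    by_cases h : uncentred 𝕜 n p (u i • dir i u) = p
    · simp only [h, dite_true, mem_ofPred_eq]
      obtain ⟨a, ha, h'⟩ := exists_rep_mk (dir i u) (dir_ne_zero i u)
      exact (h' i).trans_ne (by simpa using ha)
    · simp only [h, dite_false, mem_ofPred_eq]
      refine ⟨uncentred_mem p _ hu, ?_⟩
      rw [centred_uncentred p _ hu]
      have h0 : u i ≠ 0 := fun h0 => h ((uncentred_eq_iff p _ hu).2 ((smul_dir_eq_zero i u).2 h0))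
      simpa using h0
  left_inv' z hz := by
    cases z with
    | off x hx =>
      have h1 : uncentred 𝕜 n p (affineCoord i (centred 𝕜 n p x) i •
          dir i (affineCoord i (centred 𝕜 n p x))) = x := by
        rw [smul_dir_affineCoord i _ hz.2, uncentred_centred p x hz.1]
      have h2 := h1.trans_ne hx
      simp only [h2, dite_false]
      exact off_congr h1 _ _
    | exc L =>
      have h1 : uncentred 𝕜 n p (lineCoord i L i • dir i (lineCoord i L)) = p := by
        have : lineCoord i L i = 0 := by simp
        rw [this, zero_smul, uncentred_zero]
      simp only [h1, dite_true]
      exact congrArg Blowup.exc (mk_dir_lineCoord i L hz)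
  right_inv' u hu := by
    by_cases h : uncentred 𝕜 n p (u i • dir i u) = p
    · have h0 : u i = 0 := (smul_dir_eq_zero i u).1 ((uncentred_eq_iff p _ hu).1 h)
      simp only [h, dite_true]
      ext j
      rw [lineCoord_mk]
      by_cases hj : j = i
      · subst hj; simp [h0]
      · simp [hj]
    · have h0 : u i ≠ 0 := fun h0 => h ((uncentred_eq_iff p _ hu).2 ((smul_dir_eq_zero i u).2 h0))
      simp only [h, dite_false]
      rw [centred_uncentred p _ hu, affineCoord_smul_dir i u h0]

/-- The coordinate change from `c` to `c'` has open domain and is `C^m`. -/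
def GoodChange {p : M} (m : WithTop ℕ∞) (c c' : PartialEquiv (Blowup 𝕜 n p) (Coord 𝕜 n)) : Prop :=
  ∀ u, u ∈ c.target → c.symm u ∈ c'.source →
    (∀ᶠ w in 𝓝 u, w ∈ c.target ∧ c.symm w ∈ c'.source) ∧ ContDiffAt 𝕜 m (c' ∘ c.symm) u

theorem contDiffAt_coordChange {m : WithTop ℕ∞} [IsManifold 𝓘(𝕜, Coord 𝕜 n) m M]
    {e e' : OpenPartialHomeomorph M (Coord 𝕜 n)} (he : e ∈ atlas (Coord 𝕜 n) M)
    (he' : e' ∈ atlas (Coord 𝕜 n) M) {u : Coord 𝕜 n} (hu : u ∈ e.target)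
    (hu' : e.symm u ∈ e'.source) : ContDiffAt 𝕜 m (fun w => e' (e.symm w)) u := by
  have h1 := contMDiffOn_of_mem_contDiffGroupoid
    ((contDiffGroupoid m 𝓘(𝕜, Coord 𝕜 n)).compatible he he')
  rw [contMDiffOn_iff_contDiffOn] at h1
  have h2 : u ∈ (e.symm.trans e').source := by simp [hu, hu']
  exact h1.contDiffAt ((e.symm.trans e').open_source.mem_nhds h2)

theorem eventually_symm_mem {X Y : Type*} [TopologicalSpace X] [TopologicalSpace Y]
    {e : OpenPartialHomeomorph X Y} {u : Y}
    (hu : u ∈ e.target) {s : Set X} (hs : IsOpen s) (h : e.symm u ∈ s) :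
    ∀ᶠ w in 𝓝 u, w ∈ e.target ∧ e.symm w ∈ s :=
  (e.open_target.mem_nhds hu |> Filter.Eventually.and) <|
    (e.continuousAt_symm hu).eventually (hs.mem_nhds h)

theorem contDiff_smul_dir (m : WithTop ℕ∞) (i : Fin n) :
    ContDiff 𝕜 m (fun u : Coord 𝕜 n => u i • dir i u) := by
  rw [contDiff_euclidean]
  intro j
  by_cases hj : j = i
  · simp [hj]; fun_prop
  · simp [hj]; fun_prop

theorem contDiffAt_affineCoord (m : WithTop ℕ∞) (i : Fin n) (v : Coord 𝕜 n) (hv : v i ≠ 0) :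
    ContDiffAt 𝕜 m (affineCoord i) v := by
  rw [contDiffAt_euclidean]
  intro j
  by_cases hj : j = i
  · simp [hj]; fun_prop
  · simp only [affineCoord_apply, hj, if_false]
    exact ContDiffAt.div (by fun_prop) (by fun_prop) hv

theorem offChart_symm {p : M} (z₀ : Blowup 𝕜 n p) (e : OpenPartialHomeomorph M (Coord 𝕜 n))
    {u : Coord 𝕜 n} (hu : e.symm u ≠ p) :
    (offChart z₀ e).symm u = .off (e.symm u) hu :=
  dif_neg hu

open Classical in
theorem blowdown_excChart_symm (p : M) (i : Fin n) (u : Coord 𝕜 n) :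
    blowdown ((excChart p i).symm u) = uncentred 𝕜 n p (u i • dir i u) := by
  change blowdown (dite _ _ _) = _
  split_ifs with h
  · exact h.symm
  · rfl

theorem goodChange_off_off [T1Space M] {m : WithTop ℕ∞} [IsManifold 𝓘(𝕜, Coord 𝕜 n) m M]
    {p : M} (z₀ z₁ : Blowup 𝕜 n p) {e e' : OpenPartialHomeomorph M (Coord 𝕜 n)}
    (he : e ∈ atlas (Coord 𝕜 n) M) (he' : e' ∈ atlas (Coord 𝕜 n) M) :
    GoodChange m (offChart z₀ e) (offChart z₁ e') := by
  rintro u ⟨hu, hup⟩ hu'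
  rw [offChart_symm z₀ e hup] at hu'
  have h1 := eventually_symm_mem hu isOpen_compl_singleton hup
  have h2 := eventually_symm_mem hu e'.open_source hu'.2
  refine ⟨?_, ?_⟩
  · filter_upwards [h1, h2] with w hw hw'
    refine ⟨⟨hw.1, hw.2⟩, ?_⟩
    rw [offChart_symm z₀ e hw.2]
    exact ⟨hw.2, hw'.2⟩
  · refine (contDiffAt_coordChange he he' hu hu'.2).congr_of_eventuallyEq ?_
    filter_upwards [h1] with w hw
    simp only [Function.comp, offChart_symm z₀ e hw.2]
    rfl

theorem goodChange_off_exc [T1Space M] {m : WithTop ℕ∞} [IsManifold 𝓘(𝕜, Coord 𝕜 n) m M]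
    {p : M} (z₀ : Blowup 𝕜 n p) {e : OpenPartialHomeomorph M (Coord 𝕜 n)}
    (he : e ∈ atlas (Coord 𝕜 n) M) (i : Fin n) :
    GoodChange m (offChart z₀ e) (excChart p i) := by
  rintro u ⟨hu, hup⟩ hu'
  rw [offChart_symm z₀ e hup] at hu'
  have h1 := eventually_symm_mem hu isOpen_compl_singleton hup
  have h2 := eventually_symm_mem hu (chartAt (Coord 𝕜 n) p).open_source hu'.1
  have h3 : ContDiffAt 𝕜 m (fun w => centred 𝕜 n p (e.symm w)) u :=
    (contDiffAt_coordChange he (chart_mem_atlas _ p) hu hu'.1).sub contDiffAt_const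
  have h4 : ∀ᶠ w in 𝓝 u, centred 𝕜 n p (e.symm w) i ≠ 0 :=
    ((EuclideanSpace.proj (𝕜 := 𝕜) i).continuous.continuousAt.comp h3.continuousAt).eventually_ne
      hu'.2
  refine ⟨?_, ?_⟩
  · filter_upwards [h1, h2, h4] with w hw hw' hw''
    refine ⟨⟨hw.1, hw.2⟩, ?_⟩
    rw [offChart_symm z₀ e hw.2]
    exact ⟨hw'.2, hw''⟩
  · refine ((contDiffAt_affineCoord m i _ hu'.2).comp u h3).congr_of_eventuallyEq ?_
    filter_upwards [h1] with w hw
    simp only [Function.comp, offChart_symm z₀ e hw.2]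
    rfl

theorem goodChange_exc_off [T1Space M] {m : WithTop ℕ∞} [IsManifold 𝓘(𝕜, Coord 𝕜 n) m M]
    {p : M} (z₀ : Blowup 𝕜 n p) {e : OpenPartialHomeomorph M (Coord 𝕜 n)}
    (he : e ∈ atlas (Coord 𝕜 n) M) (i : Fin n) :
    GoodChange m (excChart p i) (offChart z₀ e) := by
  rintro u hu ⟨hup, hu'⟩
  rw [blowdown_excChart_symm] at hup hu'
  have h0 : Filter.Tendsto (fun w : Coord 𝕜 n => chartAt (Coord 𝕜 n) p p + w i • dir i w) (𝓝 u)
      (𝓝 (chartAt (Coord 𝕜 n) p p + u i • dir i u)) :=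
    (continuous_const.add (contDiff_smul_dir (𝕜 := 𝕜) 0 i).continuous).continuousAt
  have h1 := h0.eventually (eventually_symm_mem hu isOpen_compl_singleton hup)
  have h2 := h0.eventually (eventually_symm_mem hu e.open_source hu')
  refine ⟨?_, ?_⟩
  · filter_upwards [h1, h2] with w hw hw'
    refine ⟨hw.1, ?_, ?_⟩
    · rw [blowdown_excChart_symm]; exact hw.2
    · rw [blowdown_excChart_symm]; exact hw'.2
  · have h3 := (contDiffAt_coordChange (m := m) (chart_mem_atlas _ p) he hu hu').comp u
      (contDiffAt_const.add (contDiff_smul_dir m i).contDiffAt)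
    refine h3.congr_of_eventuallyEq (Filter.Eventually.of_forall fun w => ?_)
    exact congrArg e (blowdown_excChart_symm p i w)

open Classical in
theorem excChart_symm_mem_iff (p : M) (i j : Fin n) {u : Coord 𝕜 n}
    (hu : u ∈ (excChart p i).target) :
    (excChart p i).symm u ∈ (excChart p j).source ↔ dir i u j ≠ 0 := by
  by_cases h : uncentred 𝕜 n p (u i • dir i u) = p
  · have h1 : (excChart p i).symm u = .exc (Projectivization.mk 𝕜 (dir i u) (dir_ne_zero i u)) :=
      dif_pos h
    rw [h1]
    change (Projectivization.mk 𝕜 (dir i u) _).rep j ≠ 0 ↔ _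
    obtain ⟨a, ha, h'⟩ := exists_rep_mk (dir i u) (dir_ne_zero i u)
    rw [h', ne_eq, mul_eq_zero]
    simp only [ha, false_or, ne_eq]
  · have h1 : (excChart p i).symm u = .off (uncentred 𝕜 n p (u i • dir i u)) h := dif_neg h
    have h0 : u i ≠ 0 := fun h0 => h ((uncentred_eq_iff p _ hu).2 ((smul_dir_eq_zero i u).2 h0))
    rw [h1]
    change (_ ∧ centred 𝕜 n p _ j ≠ 0) ↔ _
    rw [centred_uncentred p _ hu]
    simp only [uncentred_mem p _ hu, true_and, PiLp.smul_apply, smul_eq_mul]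
    simp only [ne_eq, mul_eq_zero, h0, false_or]

open Classical in
theorem excChart_excChart_symm (p : M) (i j : Fin n) {u : Coord 𝕜 n}
    (hu : u ∈ (excChart p i).target) (l : Fin n) :
    excChart p j ((excChart p i).symm u) l =
      if l = j then u i * dir i u j else dir i u l / dir i u j := by
  by_cases h : uncentred 𝕜 n p (u i • dir i u) = p
  · have h1 : (excChart p i).symm u = .exc (Projectivization.mk 𝕜 (dir i u) (dir_ne_zero i u)) :=
      dif_pos h
    have h0 : u i = 0 := (smul_dir_eq_zero i u).1 ((uncentred_eq_iff p _ hu).1 h)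
    rw [h1]
    refine (lineCoord_mk j (dir i u) (dir_ne_zero i u) l).trans ?_
    rw [h0, zero_mul]
  · have h1 : (excChart p i).symm u = .off (uncentred 𝕜 n p (u i • dir i u)) h := dif_neg h
    have h0 : u i ≠ 0 := fun h0 => h ((uncentred_eq_iff p _ hu).2 ((smul_dir_eq_zero i u).2 h0))
    rw [h1]
    change affineCoord j (centred 𝕜 n p _) l = _
    rw [centred_uncentred p _ hu]
    simp only [affineCoord_apply, PiLp.smul_apply, smul_eq_mul]
    rw [mul_div_mul_left _ _ h0]

theorem goodChange_exc_exc (m : WithTop ℕ∞) (p : M) (i j : Fin n) :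
    GoodChange m (excChart (𝕜 := 𝕜) p i) (excChart p j) := by
  intro u hu hu'
  have h0 : Filter.Tendsto (fun w : Coord 𝕜 n => chartAt (Coord 𝕜 n) p p + w i • dir i w) (𝓝 u)
      (𝓝 (chartAt (Coord 𝕜 n) p p + u i • dir i u)) :=
    (continuous_const.add (contDiff_smul_dir (𝕜 := 𝕜) 0 i).continuous).continuousAt
  have h1 : ∀ᶠ w in 𝓝 u, w ∈ (excChart p i).target :=
    h0.eventually ((chartAt (Coord 𝕜 n) p).open_target.mem_nhds hu)
  have hd : ∀ l, ContDiff 𝕜 m (fun w : Coord 𝕜 n => dir i w l) := by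
    intro l
    by_cases hl : l = i
    · simp [hl]; fun_prop
    · simp [hl]; fun_prop
  have hj := (excChart_symm_mem_iff p i j hu).1 hu'
  have h2 : ∀ᶠ w in 𝓝 u, dir i w j ≠ 0 := (hd j).continuous.continuousAt.eventually_ne hj
  refine ⟨?_, ?_⟩
  · filter_upwards [h1, h2] with w hw hw'
    exact ⟨hw, (excChart_symm_mem_iff p i j hw).2 hw'⟩
  · rw [contDiffAt_euclidean]
    intro l
    have h3 : ContDiffAt 𝕜 m (fun w : Coord 𝕜 n =>
        if l = j then w i * dir i w j else dir i w l / dir i w j) u := by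
      by_cases hl : l = j
      · simp only [hl, if_true]
        exact ContDiffAt.mul (by fun_prop) (hd j).contDiffAt
      · simp only [hl, if_false]
        exact (hd l).contDiffAt.div (hd j).contDiffAt hj
    refine h3.congr_of_eventuallyEq ?_
    filter_upwards [h1] with w hw
    exact excChart_excChart_symm p i j hw l

/-- The atlas of the blowup. -/
def blowupAtlas (𝕜 : Type) [RCLike 𝕜] (n : ℕ) {M : Type*} [TopologicalSpace M]
    [ChartedSpace (Coord 𝕜 n) M] (p : M) : Set (PartialEquiv (Blowup 𝕜 n p) (Coord 𝕜 n)) :=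
  {c | (∃ z₀, ∃ e ∈ atlas (Coord 𝕜 n) M, c = offChart z₀ e) ∨ ∃ i, c = excChart p i}

theorem goodChange_of_mem [T1Space M] {m : WithTop ℕ∞} [IsManifold 𝓘(𝕜, Coord 𝕜 n) m M]
    {p : M} {c c' : PartialEquiv (Blowup 𝕜 n p) (Coord 𝕜 n)} (hc : c ∈ blowupAtlas 𝕜 n p)
    (hc' : c' ∈ blowupAtlas 𝕜 n p) : GoodChange m c c' := by
  rcases hc with ⟨z₀, e, he, rfl⟩ | ⟨i, rfl⟩ <;> rcases hc' with ⟨z₁, e', he', rfl⟩ | ⟨j, rfl⟩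
  · exact goodChange_off_off z₀ z₁ he he'
  · exact goodChange_off_exc z₀ he j
  · exact goodChange_exc_off z₁ he' i
  · exact goodChange_exc_exc m p i j

/-- The charts of the blowup, with their compatibility. -/
noncomputable def blowupCore (𝕜 : Type) [RCLike 𝕜] (n : ℕ) {M : Type*} [TopologicalSpace M]
    [T1Space M] [ChartedSpace (Coord 𝕜 n) M] (p : M) :
    ChartedSpaceCore (Coord 𝕜 n) (Blowup 𝕜 n p) where
  atlas := blowupAtlas 𝕜 n p
  chartAt z := match z with
    | .off x hx => offChart (.off x hx) (chartAt (Coord 𝕜 n) x)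
    | .exc L => excChart p (exists_rep_ne_zero L).choose
  mem_chart_source z := by
    cases z with
    | off x hx => exact ⟨hx, mem_chart_source _ x⟩
    | exc L => exact (exists_rep_ne_zero L).choose_spec
  chart_mem_atlas z := by
    cases z with
    | off x hx => exact Or.inl ⟨_, _, chart_mem_atlas _ x, rfl⟩
    | exc L => exact Or.inr ⟨_, rfl⟩
  open_source c c' hc hc' := by
    rw [isOpen_iff_mem_nhds]
    rintro u ⟨hu, hu'⟩
    exact (goodChange_of_mem (m := 0) hc hc' u hu hu').1
  continuousOn_toFun c c' hc hc' := by
    rintro u ⟨hu, hu'⟩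
    exact (goodChange_of_mem (m := 0) hc hc' u hu hu').2.continuousAt.continuousWithinAt

noncomputable instance instTopologicalSpaceBlowup [T1Space M] (p : M) :
    TopologicalSpace (Blowup 𝕜 n p) :=
  (blowupCore 𝕜 n p).toTopologicalSpace

noncomputable instance instChartedSpaceBlowup [T1Space M] (p : M) :
    ChartedSpace (Coord 𝕜 n) (Blowup 𝕜 n p) :=
  (blowupCore 𝕜 n p).toChartedSpace

/-- The blowup of a `C^m` (respectively analytic) manifold is again one. -/
instance instIsManifoldBlowup [T1Space M] (m : WithTop ℕ∞) [IsManifold 𝓘(𝕜, Coord 𝕜 n) m M]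
    (p : M) : IsManifold 𝓘(𝕜, Coord 𝕜 n) m (Blowup 𝕜 n p) := by
  refine isManifold_of_contDiffOn _ _ _ fun e e' he he' => ?_
  have key : ∀ e ∈ atlas (Coord 𝕜 n) (Blowup 𝕜 n p), e.toPartialEquiv ∈ blowupAtlas 𝕜 n p := by
    intro e he
    obtain ⟨c, hc, rfl⟩ : ∃ c, ∃ hc : c ∈ blowupAtlas 𝕜 n p,
        e = (blowupCore 𝕜 n p).openPartialHomeomorph c hc := by
      have he' : e ∈ ⋃ (c : PartialEquiv (Blowup 𝕜 n p) (Coord 𝕜 n))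
          (hc : c ∈ (blowupCore 𝕜 n p).atlas), {(blowupCore 𝕜 n p).openPartialHomeomorph c hc} := he
      simp only [mem_iUnion, mem_singleton_iff] at he'
      exact he'
    exact hc
  rintro u ⟨⟨hu, hu'⟩, -⟩
  exact (goodChange_of_mem (m := m) (key e he) (key e' he') u hu hu').2.contDiffWithinAt

theorem isOpen_source_preimage [T1Space M] {p : M}
    {c : PartialEquiv (Blowup 𝕜 n p) (Coord 𝕜 n)} (hc : c ∈ blowupAtlas 𝕜 n p)
    {s : Set (Coord 𝕜 n)} (hs : IsOpen s) : IsOpen (c.source ∩ c ⁻¹' s) :=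
  ((blowupCore 𝕜 n p).openPartialHomeomorph c hc).isOpen_inter_preimage hs

theorem continuous_blowdown [T1Space M] (p : M) :
    Continuous (blowdown : Blowup 𝕜 n p → M) := by
  rw [continuous_def]
  intro s hs
  rw [isOpen_iff_mem_nhds]
  intro z hz
  cases z with
  | off x hx =>
    have hx' : x ∈ s := hz
    set e := chartAt (Coord 𝕜 n) x
    have hc : offChart (.off x hx) e ∈ blowupAtlas 𝕜 n p :=
      Or.inl ⟨_, _, chart_mem_atlas _ x, rfl⟩
    have hxe : x ∈ e.source := mem_chart_source _ x
    have hin : (Blowup.off x hx : Blowup 𝕜 n p) ∈ (offChart (.off x hx) e).source ∩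
        offChart (.off x hx) e ⁻¹' (e.target ∩ e.symm ⁻¹' s) := by
      refine ⟨⟨hx, hxe⟩, e.map_source hxe, ?_⟩
      change e.symm (e x) ∈ s
      rwa [e.left_inv hxe]
    refine Filter.mem_of_superset
      ((isOpen_source_preimage hc (e.isOpen_inter_preimage_symm hs)).mem_nhds hin) ?_
    · rintro y ⟨hy, -, hy'⟩
      change e.symm (e (blowdown y)) ∈ s at hy'
      rwa [e.left_inv hy.2] at hy'
  | exc L =>
    have hp : p ∈ s := hz
    obtain ⟨i, hi⟩ := exists_rep_ne_zero L
    have hc : excChart p i ∈ blowupAtlas 𝕜 n p := Or.inr ⟨i, rfl⟩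
    have h0 : Continuous fun w : Coord 𝕜 n => chartAt (Coord 𝕜 n) p p + w i • dir i w :=
      continuous_const.add (contDiff_smul_dir (𝕜 := 𝕜) 0 i).continuous
    have ho := ((chartAt (Coord 𝕜 n) p).isOpen_inter_preimage_symm hs).preimage h0
    have hin : (Blowup.exc L : Blowup 𝕜 n p) ∈ (excChart p i).source := hi
    have hsymm : ∀ y ∈ (excChart (𝕜 := 𝕜) p i).source,
        uncentred 𝕜 n p ((excChart p i y) i • dir i (excChart p i y)) = blowdown y := by
      intro y hy
      rw [← blowdown_excChart_symm, (excChart p i).left_inv hy]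
    refine Filter.mem_of_superset ((isOpen_source_preimage hc ho).mem_nhds (x := .exc L)
        ⟨hin, (excChart p i).map_source hin, ?_⟩) ?_
    · change uncentred 𝕜 n p _ ∈ s
      rw [hsymm _ hin]
      exact hp
    · rintro y ⟨hy, -, hy'⟩
      change uncentred 𝕜 n p _ ∈ s at hy'
      rwa [hsymm y hy] at hy'

/-- The blowup of a Hausdorff manifold is Hausdorff. -/
instance instT2SpaceBlowup [T2Space M] (p : M) : T2Space (Blowup 𝕜 n p) := by
  refine ⟨fun z z' hzz' => ?_⟩
  by_cases hq : blowdown z = blowdown z'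
  · cases z with
    | off x hx =>
      cases z' with
      | off y hy => exact absurd (off_congr hq hx hy) hzz'
      | exc L => exact absurd hq hx
    | exc L =>
      cases z' with
      | off y hy => exact absurd hq.symm hy
      | exc L' =>
        have same : ∀ i, L.rep i ≠ 0 → L'.rep i ≠ 0 → ∃ u v : Set (Blowup 𝕜 n p),
            IsOpen u ∧ IsOpen v ∧ Blowup.exc L ∈ u ∧ Blowup.exc L' ∈ v ∧ Disjoint u v := by
          intro i hi hi'
          have hc : excChart (𝕜 := 𝕜) p i ∈ blowupAtlas 𝕜 n p := Or.inr ⟨i, rfl⟩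
          obtain ⟨s, t, hs, ht, hLs, hLt, hst⟩ := t2_separation
            ((excChart (𝕜 := 𝕜) p i).injOn.ne (x := .exc L) (y := .exc L') hi hi' hzz')
          exact ⟨_, _, isOpen_source_preimage hc hs, isOpen_source_preimage hc ht, ⟨hi, hLs⟩,
            ⟨hi', hLt⟩, (hst.preimage _).mono inter_subset_right inter_subset_right⟩
        obtain ⟨i, hi⟩ := exists_rep_ne_zero L
        obtain ⟨j, hj⟩ := exists_rep_ne_zero L'
        by_cases hi' : L'.rep i = 0
        · by_cases hj' : L.rep j = 0
          · have hij : j ≠ i := by rintro rfl; exact hi hj'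
            have hci : excChart (𝕜 := 𝕜) p i ∈ blowupAtlas 𝕜 n p := Or.inr ⟨i, rfl⟩
            have hcj : excChart (𝕜 := 𝕜) p j ∈ blowupAtlas 𝕜 n p := Or.inr ⟨j, rfl⟩
            have ho : ∀ l : Fin n, IsOpen {w : Coord 𝕜 n | ‖w l‖ < 1} := fun l =>
              isOpen_lt (by fun_prop) continuous_const
            refine ⟨_, _, isOpen_source_preimage hci (ho j), isOpen_source_preimage hcj (ho i),
              ⟨hi, ?_⟩, ⟨hj, ?_⟩, ?_⟩
            · change ‖lineCoord i L j‖ < 1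
              simp [hij, hj']
            · change ‖lineCoord j L' i‖ < 1
              simp [hij.symm, hi']
            · rw [Set.disjoint_left]
              rintro y ⟨hy, hy1⟩ ⟨hy', hy2⟩
              change ‖excChart p i y j‖ < 1 at hy1
              change ‖excChart p j y i‖ < 1 at hy2
              have ht := (excChart p i).map_source hy
              have h1 := excChart_excChart_symm p i j ht i
              rw [(excChart p i).left_inv hy, if_neg hij.symm] at h1
              have h2 := (excChart_symm_mem_iff p i j ht).1
                (by rw [(excChart p i).left_inv hy]; exact hy')
              rw [h1] at hy2
              simp only [dir_apply, hij, if_true, if_false, norm_div, norm_one] at hy2 h2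
              have h3 : 0 < ‖excChart p i y j‖ := norm_pos_iff.2 h2
              rw [div_lt_one h3] at hy2
              exact absurd hy1 (not_lt.2 hy2.le)
          · exact same j hj' hj
        · exact same i hi hi'
  · obtain ⟨s, t, hs, ht, hxs, hyt, hst⟩ := t2_separation hq
    exact ⟨_, _, hs.preimage (continuous_blowdown p), ht.preimage (continuous_blowdown p), hxs,
      hyt, hst.preimage _⟩

/-- `ĥ` is the blowup of the map `h`, where `h` fixes `p`: it is given by `x ↦ h(x)` off the
exceptional locus, and by `[v] ↦ [Dh|_p(v)]` on the exceptional locus. -/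
structure IsBlowupMap [T1Space M] {p : M} (h : M → M)
    (h' : Blowup 𝕜 n p → Blowup 𝕜 n p) : Prop where
  off : ∀ (x : M) (hx : x ≠ p), ∃ hy : h x ≠ p, h' (.off x hx) = .off (h x) hy
  exc : ∀ (v : Coord 𝕜 n) (hv : v ≠ 0),
    ∃ hw : (mfderiv 𝓘(𝕜, Coord 𝕜 n) 𝓘(𝕜, Coord 𝕜 n) h p v : Coord 𝕜 n) ≠ 0,
      h' (.exc (Projectivization.mk 𝕜 v hv)) =
        .exc (Projectivization.mk 𝕜
          (mfderiv 𝓘(𝕜, Coord 𝕜 n) 𝓘(𝕜, Coord 𝕜 n) h p v : Coord 𝕜 n) hw)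

end Construction

/-- The group of `C^k` diffeomorphisms `f` of `X` with `f(A) = A`. For `k = 0` these are
homeomorphisms. For `𝕜 = ℂ` and `k = ω` (analytic) these are biholomorphisms. -/
def Aut (𝕜 : Type) [RCLike 𝕜] (n : ℕ) (k : WithTop ℕ∞) (X : Type*) [TopologicalSpace X]
    [ChartedSpace (Coord 𝕜 n) X] (A : Set X) : Subgroup (X ≃ₜ X) where
  carrier := {f | ContMDiff 𝓘(𝕜, Coord 𝕜 n) 𝓘(𝕜, Coord 𝕜 n) k f ∧
    ContMDiff 𝓘(𝕜, Coord 𝕜 n) 𝓘(𝕜, Coord 𝕜 n) k f.symm ∧ f '' A = A}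
  mul_mem' {f g} hf hg := by
    refine ⟨hf.1.comp hg.1, hg.2.1.comp hf.2.1, ?_⟩
    change (f ∘ g) '' A = A
    rw [image_comp, hg.2.2, hf.2.2]
  one_mem' := ⟨contMDiff_id, contMDiff_id, image_id A⟩
  inv_mem' {f} hf := by
    refine ⟨hf.2.1, hf.1, ?_⟩
    change f.symm '' A = A
    conv_lhs => rw [← hf.2.2]
    exact f.toEquiv.symm_image_image A

/-- The `C^k` compact-open (weak) topology on `Aut 𝕜 n k X A`. A subbasic set consists of all `g`
that are `ε`-close to a given `f` in a given pair of charts on a given compact set, together with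
all derivatives of order at most `r`, for a finite `r ≤ k`. -/
@[reducible]
def weakTopology (𝕜 : Type) [RCLike 𝕜] (n : ℕ) (k : WithTop ℕ∞) (X : Type*) [TopologicalSpace X]
    [ChartedSpace (Coord 𝕜 n) X] (A : Set X) : TopologicalSpace (Aut 𝕜 n k X A) :=
  TopologicalSpace.generateFrom
    {N | ∃ (f : Aut 𝕜 n k X A) (e e' : OpenPartialHomeomorph X (Coord 𝕜 n)) (K : Set X) (r : ℕ)
      (ε : ℝ), e ∈ atlas (Coord 𝕜 n) X ∧ e' ∈ atlas (Coord 𝕜 n) X ∧ IsCompact K ∧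
      K ⊆ e.source ∧ MapsTo f.1 K e'.source ∧ (r : WithTop ℕ∞) ≤ k ∧ 0 < ε ∧
      N = {g | MapsTo g.1 K e'.source ∧ ∀ x ∈ K, ∀ j ≤ r,
        ‖iteratedFDeriv 𝕜 j (e' ∘ g.1 ∘ e.symm) (e x) -
          iteratedFDeriv 𝕜 j (e' ∘ f.1 ∘ e.symm) (e x)‖ < ε}}

/-- The compact-open topology on `Aut 𝕜 n k X A`. -/
@[reducible]
def compactOpenTopology (𝕜 : Type) [RCLike 𝕜] (n : ℕ) (k : WithTop ℕ∞) (X : Type*)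
    [TopologicalSpace X] [ChartedSpace (Coord 𝕜 n) X] (A : Set X) :
    TopologicalSpace (Aut 𝕜 n k X A) :=
  TopologicalSpace.induced (fun f => (f.1 : C(X, X))) ContinuousMap.compactOpen

end ClassicalBlowup

/-! Write `h` in the chart centred at `p` as a map `G` with `G 0 = 0`. Hadamard's lemma gives `G v =
A v v`, where `A v = ∫₀¹ DG(s v) ds` is a family of linear maps, one class less regular than `G`,
with `A 0 = Dh|_p`. The `i`-th affine chart of the blowup describes a point by `v = u_i d`, with `d
= dir i u`, so `G v = u_i • A(u_i d) d`. The factor `u_i` cancels in quotients of coordinates, and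
in the `j`-th chart the lift reads `(u_i (A d)_j, (A d)_l / (A d)_j)`. Because `A 0 = Dh|_p`, the
same formula is valid on `u_i = 0`. It is rational in `A(u_i d)` and `u`, with denominator nonzero
for a suitable `j`, so the lift is as regular as `A`: one derivative is lost. Off the exceptional
locus the lift is just `h` in charts of `M`. In the analytic case `A` comes from shifting the power
series of `G`, and nothing is lost. The computation is `IsBlowupMap.excChart_apply`; the
factorizations are `radialMean_fderiv_apply` and `exists_clm_factor_of_analyticAt`.

Regularity and continuity are treated together by means of families of maps whose derivatives up to
a finite order `r` are jointly continuous in parameter and point. Continuity into the weak topology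
amounts to having such a family for every finite `r ≤ k`. Hadamard's lemma with parameters turns a
`C^(r+1)` family downstairs into a `C^r` family upstairs (`ContMDiffFamilyAt.blowup_exc`). A
one-point parameter space gives the regularity of a single lift; the automorphism group as parameter
space gives continuity of `β`. In the holomorphic case, compact-open continuity is joint continuity,
Cauchy's estimate upgrades it to a `C^1` family, and the lift is then a `C^0` family, which
suffices.

The lift is determined by its defining relations, so the chain rule makes `β` a homomorphism, and
blowing down recovers `h`, so `β` is injective. In the plane examples `A` is explicit and depends
only on the first coordinate; the lift contains the factor `A` itself, whereas `h` contains only its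
product with a coordinate, which is smoother. -/

namespace ClassicalBlowup

/-! ### Parametrized families of `C^r` maps between normed spaces -/

section Families

open Filter

variable {𝕜 : Type} [RCLike 𝕜] {T : Type*} [TopologicalSpace T]
  {E F G : Type*} [NormedAddCommGroup E] [NormedSpace 𝕜 E]
  [NormedAddCommGroup F] [NormedSpace 𝕜 F] [NormedAddCommGroup G] [NormedSpace 𝕜 G]

/-- The maps `f s` are `C^r` near `x` for all parameters `s` near `t`, and their derivatives of
order at most `r` are jointly continuous at `(t, x)`. -/
def ContDiffFamilyAt (𝕜 : Type) [RCLike 𝕜] {T : Type*} [TopologicalSpace T]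
    {E F : Type*} [NormedAddCommGroup E] [NormedSpace 𝕜 E] [NormedAddCommGroup F]
    [NormedSpace 𝕜 F] (r : ℕ) (f : T → E → F) (t : T) (x : E) : Prop :=
  (∀ᶠ q : T × E in 𝓝 (t, x), ContDiffAt 𝕜 r (f q.1) q.2) ∧
    ∀ j ≤ r, ContinuousAt (fun q : T × E => iteratedFDeriv 𝕜 j (f q.1) q.2) (t, x)

/-- Derivatives at a point see only a neighbourhood in the slice over a fixed parameter; this passes
from joint neighbourhoods to such slices. -/
theorem eventually_nhds_slice {X : Type*} [TopologicalSpace X] {t : T} {x : X}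
    {P : T × X → Prop} (h : ∀ᶠ q in 𝓝 (t, x), P q) :
    ∀ᶠ q in 𝓝 (t, x), ∀ᶠ y in 𝓝 q.2, P (q.1, y) := by
  filter_upwards [h.eventually_nhds] with q hq
  exact ((Continuous.prodMk_right q.1).continuousAt (x := q.2)).eventually hq

namespace ContDiffFamilyAt

variable {r : ℕ} {f : T → E → F} {t : T} {x : E}

theorem continuousAt (h : ContDiffFamilyAt 𝕜 r f t x) :
    ContinuousAt (fun q : T × E => f q.1 q.2) (t, x) := by
  have h0 := h.2 0 (Nat.zero_le _)
  simp only [iteratedFDeriv_zero_eq_comp, Function.comp_apply] at h0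
  simpa [Function.comp_def] using
    (continuousMultilinearCurryFin0 𝕜 E F).continuous.continuousAt.comp h0

theorem contDiffAt (h : ContDiffFamilyAt 𝕜 r f t x) : ContDiffAt 𝕜 r (f t) x :=
  h.1.self_of_nhds

theorem of_le {m : ℕ} (h : ContDiffFamilyAt 𝕜 r f t x) (hm : m ≤ r) :
    ContDiffFamilyAt 𝕜 m f t x :=
  ⟨h.1.mono fun _ hq => hq.of_le (by exact_mod_cast hm), fun j hj => h.2 j (hj.trans hm)⟩

theorem const {g : E → F} (hg : ContDiffAt 𝕜 r g x) (t : T) :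
    ContDiffFamilyAt 𝕜 r (fun _ => g) t x := by
  have hs : Tendsto (Prod.snd : T × E → E) (𝓝 (t, x)) (𝓝 x) := continuous_snd.continuousAt
  refine ⟨hs.eventually (hg.eventually (by simp)), fun j hj => ?_⟩
  have : ContinuousAt (iteratedFDeriv 𝕜 j g) x :=
    (hg.iteratedFDeriv_right (m := 0) (i := j) (by simpa using hj)).continuousAt
  exact this.comp_of_eq hs rfl

theorem congr {g : T → E → F} (h : ContDiffFamilyAt 𝕜 r f t x)
    (hfg : ∀ᶠ q : T × E in 𝓝 (t, x), g q.1 q.2 = f q.1 q.2) :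
    ContDiffFamilyAt 𝕜 r g t x := by
  have hs := eventually_nhds_slice hfg
  refine ⟨?_, fun j hj => (h.2 j hj).congr ?_⟩
  · filter_upwards [h.1, hs] with q hq hq'
    exact hq.congr_of_eventuallyEq hq'
  · filter_upwards [hs] with q hq
    exact (EventuallyEq.iteratedFDeriv 𝕜 (f₁ := g q.1) (f₂ := f q.1) hq j).eq_of_nhds.symm

/-- By the Faà di Bruno formula, a derivative of the composite is a finite sum, over ordered
partitions, of expressions continuous in the derivatives of the two factors, so joint continuity is
inherited. -/
theorem comp {g : T → F → G} (hg : ContDiffFamilyAt 𝕜 r g t (f t x))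
    (hf : ContDiffFamilyAt 𝕜 r f t x) :
    ContDiffFamilyAt 𝕜 r (fun s => g s ∘ f s) t x := by
  have hc : ContinuousAt (fun q : T × E => (q.1, f q.1 q.2)) (t, x) :=
    continuousAt_fst.prodMk hf.continuousAt
  have hg1 := hc.eventually (p := fun q : T × F => ContDiffAt 𝕜 r (g q.1) q.2) hg.1
  refine ⟨?_, fun j hj => ?_⟩
  · filter_upwards [hf.1, hg1] with q h1 h2
    exact h2.comp q.2 h1
  · have key : ContinuousAt (fun q : T × E =>
        (ftaylorSeries 𝕜 (g q.1) (f q.1 q.2)).taylorComp (ftaylorSeries 𝕜 (f q.1) q.2) j)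
        (t, x) := by
      unfold FormalMultilinearSeries.taylorComp
      refine tendsto_finsetSum _ fun c _ => ?_
      have hG : ContinuousAt (fun q : T × E =>
          iteratedFDeriv 𝕜 c.length (g q.1) (f q.1 q.2)) (t, x) :=
        ContinuousAt.comp (f := fun q : T × E => (q.1, f q.1 q.2))
          (g := fun q : T × F => iteratedFDeriv 𝕜 c.length (g q.1) q.2)
          (hg.2 _ (c.length_le.trans hj)) hc
      have hF : ContinuousAt (fun (q : T × E) (i : Fin c.length) =>
          iteratedFDeriv 𝕜 (c.partSize i) (f q.1) q.2) (t, x) :=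
        continuousAt_pi.2 fun i => hf.2 _ ((c.partSize_le i).trans hj)
      have hL := ((c.compAlongOrderedFinpartitionL 𝕜 E F G).continuous.continuousAt).comp hG
      have he : Continuous fun p : (ContinuousMultilinearMap 𝕜
          (fun i : Fin c.length => E [×c.partSize i]→L[𝕜] F) (E [×j]→L[𝕜] G)) ×
          (∀ i : Fin c.length, E [×c.partSize i]→L[𝕜] F) => p.1 p.2 := by fun_prop
      exact he.continuousAt.comp (hL.prodMk hF)
    refine key.congr ?_
    filter_upwards [hf.1, hg1] with q h1 h2
    exact (iteratedFDeriv_comp h2 h1 (by exact_mod_cast hj)).symm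

theorem postcomp {g : F → G} (hg : ContDiffAt 𝕜 r g (f t x)) (hf : ContDiffFamilyAt 𝕜 r f t x) :
    ContDiffFamilyAt 𝕜 r (fun s => g ∘ f s) t x :=
  (const hg t).comp hf

theorem prodMk {g : T → E → G} (hf : ContDiffFamilyAt 𝕜 r f t x)
    (hg : ContDiffFamilyAt 𝕜 r g t x) :
    ContDiffFamilyAt 𝕜 r (fun s y => (f s y, g s y)) t x := by
  refine ⟨?_, fun j hj => ?_⟩
  · filter_upwards [hf.1, hg.1] with q h1 h2
    exact h1.prodMk h2
  · have h := (ContinuousMultilinearMap.prodL 𝕜 (fun _ : Fin j => E) F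
      G).continuous.continuousAt.comp ((hf.2 j hj).prodMk (hg.2 j hj))
    refine h.congr ?_
    filter_upwards [hf.1, hg.1] with q h1 h2
    exact (iteratedFDeriv_prodMk h1 h2 (by exact_mod_cast hj)).symm

theorem fderiv (h : ContDiffFamilyAt 𝕜 (r + 1) f t x) :
    ContDiffFamilyAt 𝕜 r (fun s => fderiv 𝕜 (f s)) t x := by
  refine ⟨?_, fun j hj => ?_⟩
  · filter_upwards [h.1] with q hq
    exact hq.fderiv_right (by norm_cast)
  · have h1 := h.2 (j + 1) (by omega)
    simp only [iteratedFDeriv_succ_eq_comp_right, Function.comp_apply] at h1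
    have h2 := (continuousMultilinearCurryRightEquiv' 𝕜 j E F).continuous.continuousAt.comp h1
    simpa [Function.comp_def] using h2

/-- Together with `ContDiffFamilyAt.fderiv`, this allows induction on the order: a family gains one
order as soon as it is jointly continuous, differentiable nearby, and its derivative is a `C^r`
family. -/
theorem succ (hc : ContinuousAt (fun q : T × E => f q.1 q.2) (t, x))
    (hd : ∀ᶠ q : T × E in 𝓝 (t, x), DifferentiableAt 𝕜 (f q.1) q.2)
    (h : ContDiffFamilyAt 𝕜 r (fun s => _root_.fderiv 𝕜 (f s)) t x) :
    ContDiffFamilyAt 𝕜 (r + 1) f t x := by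
  refine ⟨?_, fun j hj => ?_⟩
  · filter_upwards [h.1, eventually_nhds_slice hd] with q h1 h2
    have := (contDiffAt_succ_iff_hasFDerivAt (𝕜 := 𝕜) (n := r) (f := f q.1) (x := q.2)).2
      ⟨_root_.fderiv 𝕜 (f q.1), ⟨_, h2, fun y hy => DifferentiableAt.hasFDerivAt hy⟩, h1⟩
    exact_mod_cast this
  · cases j with
    | zero =>
      simp only [iteratedFDeriv_zero_eq_comp, Function.comp_apply]
      exact (continuousMultilinearCurryFin0 𝕜 E F).symm.continuous.continuousAt.comp hc
    | succ j =>
      simp only [iteratedFDeriv_succ_eq_comp_right, Function.comp_apply]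
      exact (continuousMultilinearCurryRightEquiv' 𝕜 j E F).symm.continuous.continuousAt.comp
        (h.2 j (by omega))

end ContDiffFamilyAt

end Families

/-! ### Weighted means along rays and Hadamard's lemma -/

section RadialMean

open Filter Metric

/-- The weighted mean `∫₀¹ sᵐ f(s v) ds` of `f` along the segment from `0` to `v`. -/
noncomputable def radialMean (𝕜 : Type) [RCLike 𝕜] {E G : Type*} [NormedAddCommGroup E]
    [NormedSpace 𝕜 E] [NormedAddCommGroup G] [NormedSpace ℝ G] [NormedSpace 𝕜 G] (m : ℕ)
    (f : E → G) (v : E) : G :=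
  ∫ s in (0 : ℝ)..1, (s : 𝕜) ^ m • f ((s : 𝕜) • v)

theorem mem_Icc_of_mem_uIoc {s : ℝ} (hs : s ∈ uIoc (0 : ℝ) 1) : s ∈ Icc (0 : ℝ) 1 := by
  rw [uIoc_of_le zero_le_one] at hs
  exact Ioc_subset_Icc_self hs

variable {𝕜 : Type} [RCLike 𝕜] {T : Type*} [TopologicalSpace T]
  {E : Type*} [NormedAddCommGroup E] [NormedSpace 𝕜 E]

/-- The mean at `v` samples the whole segment from `0` to `v`, so a radius valid for all nearby
parameters is needed. -/
theorem exists_ball_of_eventually {t : T} {x : E} {P : T × E → Prop}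
    (h : ∀ᶠ q in 𝓝 (t, x), P q) :
    ∃ δ > 0, ∀ᶠ s in 𝓝 t, ∀ y ∈ ball x δ, P (s, y) := by
  rw [nhds_prod_eq] at h
  obtain ⟨p, hp, q, hq, H⟩ := eventually_prod_iff.1 h
  obtain ⟨δ, hδ, hb⟩ := Metric.eventually_nhds_iff_ball.1 hq
  exact ⟨δ, hδ, hp.mono fun s hs y hy => H hs (hb y hy)⟩

theorem ofReal_smul_mem_closedBall {s : ℝ} (hs : s ∈ Icc (0 : ℝ) 1) {ρ : ℝ} {v : E}
    (hv : v ∈ closedBall (0 : E) ρ) : (s : 𝕜) • v ∈ closedBall (0 : E) ρ := by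
  rw [mem_closedBall_zero_iff] at hv ⊢
  rw [norm_smul, RCLike.norm_ofReal, abs_of_nonneg hs.1]
  exact (mul_le_of_le_one_left (norm_nonneg _) hs.2).trans hv

theorem ofReal_smul_mem_ball {s : ℝ} (hs : s ∈ Icc (0 : ℝ) 1) {δ : ℝ} {v : E}
    (hv : v ∈ ball (0 : E) δ) : (s : 𝕜) • v ∈ ball (0 : E) δ := by
  rw [mem_ball_zero_iff] at hv ⊢
  rw [norm_smul, RCLike.norm_ofReal, abs_of_nonneg hs.1]
  exact (mul_le_of_le_one_left (norm_nonneg _) hs.2).trans_lt hv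

variable {G : Type*} [NormedAddCommGroup G] [NormedSpace ℝ G] [NormedSpace 𝕜 G]

omit [NormedSpace ℝ G] in
theorem continuousOn_radial {f : E → G} {δ : ℝ} (hf : ∀ y ∈ ball (0 : E) δ, ContinuousAt f y)
    (m : ℕ) {v : E} (hv : v ∈ ball (0 : E) δ) :
    ContinuousOn (fun s : ℝ => (s : 𝕜) ^ m • f ((s : 𝕜) • v)) (uIcc 0 1) := by
  rw [uIcc_of_le zero_le_one]
  intro s hs
  refine ContinuousAt.continuousWithinAt ?_
  have h1 : ContinuousAt (fun s : ℝ => (s : 𝕜)) s := RCLike.continuous_ofReal.continuousAt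
  exact (h1.pow m).smul ((hf _ (ofReal_smul_mem_ball hs hv)).comp
    (f := fun s : ℝ => (s : 𝕜) • v) (h1.smul continuousAt_const))

/-- Differentiation under the integral sign. The chain rule for `v ↦ s v` contributes a factor `s`,
which raises the weight from `m` to `m + 1`; this is why weighted means are considered. A slightly
smaller closed ball is compact and supplies the constant dominating function. -/
theorem hasFDerivAt_radialMean [ProperSpace E] [SMulCommClass 𝕜 ℝ G] {f : E → G}
    {δ : ℝ} (hf : ∀ y ∈ ball (0 : E) δ, ContDiffAt 𝕜 1 f y) (m : ℕ) {v : E}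
    (hv : v ∈ ball (0 : E) δ) :
    HasFDerivAt (radialMean 𝕜 m f) (radialMean 𝕜 (m + 1) (fderiv 𝕜 f) v) v := by
  obtain ⟨ρ, hvρ, hρδ⟩ := exists_between (mem_ball_zero_iff.1 hv)
  have hsub : closedBall (0 : E) ρ ⊆ ball 0 δ := closedBall_subset_ball hρδ
  have hfc : ∀ y ∈ ball (0 : E) δ, ContinuousAt f y := fun y hy => (hf y hy).continuousAt
  have hf'c : ∀ y ∈ ball (0 : E) δ, ContinuousAt (fderiv 𝕜 f) y := fun y hy =>
    ((hf y hy).fderiv_right (m := 0) (by simp)).continuousAt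
  obtain ⟨C, hC⟩ := (isCompact_closedBall (0 : E) ρ).exists_bound_of_continuousOn
    (f := fderiv 𝕜 f) fun y hy => (hf'c y (hsub hy)).continuousWithinAt
  have hball : ball (0 : E) ρ ∈ 𝓝 v := isOpen_ball.mem_nhds (mem_ball_zero_iff.2 hvρ)
  refine intervalIntegral.hasFDerivAt_integral_of_dominated_of_fderiv_le (𝕜 := 𝕜)
    (F := fun y (s : ℝ) => (s : 𝕜) ^ m • f ((s : 𝕜) • y))
    (F' := fun y (s : ℝ) => (s : 𝕜) ^ (m + 1) • fderiv 𝕜 f ((s : 𝕜) • y))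
    (bound := fun _ => C) hball ?_ ?_ ?_ ?_ ?_ ?_
  · filter_upwards [hball] with y hy
    exact (continuousOn_radial hfc m
      (hsub (ball_subset_closedBall hy))).intervalIntegrable.def'.aestronglyMeasurable
  · exact (continuousOn_radial hfc m hv).intervalIntegrable
  · exact (continuousOn_radial hf'c (m + 1) hv).intervalIntegrable.def'.aestronglyMeasurable
  · refine Eventually.of_forall fun s hs y hy => ?_
    have hs' := mem_Icc_of_mem_uIoc hs
    rw [norm_smul, norm_pow, RCLike.norm_ofReal, abs_of_nonneg hs'.1]
    exact (mul_le_of_le_one_left (norm_nonneg _) (pow_le_one₀ hs'.1 hs'.2)).trans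
      (hC _ (ofReal_smul_mem_closedBall hs' (ball_subset_closedBall hy)))
  · exact intervalIntegrable_const
  · refine Eventually.of_forall fun s hs y hy => ?_
    have hd : HasFDerivAt f (fderiv 𝕜 f ((s : 𝕜) • y)) ((s : 𝕜) • y) :=
      ((hf _ (ofReal_smul_mem_ball (mem_Icc_of_mem_uIoc hs)
        (hsub (ball_subset_closedBall hy)))).differentiableAt
        (by simp)).hasFDerivAt
    have h1 : HasFDerivAt (fun y : E => (s : 𝕜) • y) ((s : 𝕜) • ContinuousLinearMap.id 𝕜 E) y :=
      (hasFDerivAt_id y).const_smul (s : 𝕜)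
    refine ((hd.comp y h1).const_smul ((s : 𝕜) ^ m)).congr_fderiv ?_
    ext w
    simp [pow_succ, mul_smul]

/-- On a small ball around `0`, and for nearby parameters, all values of `f` are within `ε / 2` of
`f t 0`. The ball contains the segments of integration and the weights are at most `1`, so the means
are equally close. -/
theorem continuousAt_radialMean {f : T → E → G} {t : T}
    (hc : ContinuousAt (fun q : T × E => f q.1 q.2) (t, 0))
    (hf : ∀ᶠ q : T × E in 𝓝 (t, 0), ContinuousAt (f q.1) q.2) (m : ℕ) :
    ContinuousAt (fun q : T × E => radialMean 𝕜 m (f q.1) q.2) (t, 0) := by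
  refine Metric.tendsto_nhds.2 fun ε hε => ?_
  have h1 := hf.and (Metric.tendsto_nhds.1 hc (ε / 2) (half_pos hε))
  obtain ⟨δ, hδ, h2⟩ := exists_ball_of_eventually h1
  have h3 := h2.prod_nhds (ball_mem_nhds (0 : E) hδ)
  filter_upwards [h3] with q hq
  have hi : ∀ s, (∀ y ∈ ball (0 : E) δ, ContinuousAt (f s) y) → ∀ y ∈ ball (0 : E) δ,
      IntervalIntegrable (fun σ : ℝ => (σ : 𝕜) ^ m • f s ((σ : 𝕜) • y)) MeasureTheory.volume 0 1 :=
    fun s hs y hy => (continuousOn_radial hs m hy).intervalIntegrable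
  have h0 : (0 : E) ∈ ball (0 : E) δ := mem_ball_self hδ
  rw [dist_eq_norm, radialMean, radialMean, ← intervalIntegral.integral_sub
    (hi q.1 (fun y hy => (hq.1 y hy).1) q.2 hq.2)
    (hi t (fun y hy => (h2.self_of_nhds y hy).1) 0 h0)]
  refine (intervalIntegral.norm_integral_le_of_norm_le_const (C := ε / 2) fun s hs => ?_).trans_lt
    (by simpa using half_lt_self hε)
  rw [uIoc_of_le zero_le_one] at hs
  have hs' := Ioc_subset_Icc_self hs
  rw [← smul_sub, norm_smul, norm_pow, RCLike.norm_ofReal, abs_of_nonneg hs'.1]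
  refine (mul_le_of_le_one_left (norm_nonneg _) (pow_le_one₀ hs'.1 hs'.2)).trans ?_
  rw [← dist_eq_norm, smul_zero]
  exact (hq.1 _ (ofReal_smul_mem_ball hs' hq.2)).2.le

/-- Dominated convergence for a fixed parameter, at points possibly different from `0`. It supplies
the requirement that each map of the family be `C^0` near the base point. -/
theorem continuousAt_radialMean_of_ball [ProperSpace E] {f : E → G}
    {δ : ℝ} (hf : ∀ y ∈ ball (0 : E) δ, ContinuousAt f y) (m : ℕ) {v : E}
    (hv : v ∈ ball (0 : E) δ) : ContinuousAt (radialMean 𝕜 m f) v := by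
  obtain ⟨ρ, hvρ, hρδ⟩ := exists_between (mem_ball_zero_iff.1 hv)
  have hsub : closedBall (0 : E) ρ ⊆ ball 0 δ := closedBall_subset_ball hρδ
  obtain ⟨C, hC⟩ := (isCompact_closedBall (0 : E) ρ).exists_bound_of_continuousOn
    (f := f) fun y hy => (hf y (hsub hy)).continuousWithinAt
  have hball : ball (0 : E) ρ ∈ 𝓝 v := isOpen_ball.mem_nhds (mem_ball_zero_iff.2 hvρ)
  refine intervalIntegral.continuousAt_of_dominated_interval (bound := fun _ => C) ?_ ?_
    intervalIntegrable_const ?_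
  · filter_upwards [hball] with y hy
    exact (continuousOn_radial hf m
      (hsub (ball_subset_closedBall hy))).intervalIntegrable.def'.aestronglyMeasurable
  · filter_upwards [hball] with y hy
    refine Eventually.of_forall fun s hs => ?_
    have hs' := mem_Icc_of_mem_uIoc hs
    rw [norm_smul, norm_pow, RCLike.norm_ofReal, abs_of_nonneg hs'.1]
    exact (mul_le_of_le_one_left (norm_nonneg _) (pow_le_one₀ hs'.1 hs'.2)).trans
      (hC _ (ofReal_smul_mem_closedBall hs' (ball_subset_closedBall hy)))
  · refine Eventually.of_forall fun s hs => continuousAt_const.smul ?_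
    exact (hf _ (ofReal_smul_mem_ball (mem_Icc_of_mem_uIoc hs) hv)).comp
      (f := fun y : E => (s : 𝕜) • y) (continuousAt_const.smul continuousAt_id)

theorem radialMean_zero [CompleteSpace G] (f : E → G) : radialMean 𝕜 0 f 0 = f 0 := by
  simp [radialMean]

/-- **Hadamard's lemma**. -/
theorem radialMean_fderiv_apply [ProperSpace E] [IsScalarTower ℝ 𝕜 G] [SMulCommClass 𝕜 ℝ G]
    [CompleteSpace G] {f : E → G}
    {δ : ℝ} (hf : ∀ y ∈ ball (0 : E) δ, ContDiffAt 𝕜 1 f y) {v : E} (hv : v ∈ ball (0 : E) δ) :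
    radialMean 𝕜 0 (fderiv 𝕜 f) v v = f v - f 0 := by
  have hf'c : ∀ y ∈ ball (0 : E) δ, ContinuousAt (fderiv 𝕜 f) y := fun y hy =>
    ((hf y hy).fderiv_right (m := 0) (by simp)).continuousAt
  have hi := (continuousOn_radial (𝕜 := 𝕜) hf'c 0 hv)
  rw [radialMean, ContinuousLinearMap.intervalIntegral_apply hi.intervalIntegrable]
  -- The fundamental theorem of calculus for `s ↦ f (s v)` on `[0, 1]`.
  have h := intervalIntegral.integral_eq_sub_of_hasDerivAt (a := 0) (b := 1)
    (f := fun s : ℝ => f ((s : 𝕜) • v))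
    (f' := fun s : ℝ => ((s : 𝕜) ^ 0 • fderiv 𝕜 f ((s : 𝕜) • v)) v) ?_
    ((hi.clm_apply continuousOn_const).intervalIntegrable)
  · simpa using h
  · intro s hs
    rw [uIcc_of_le zero_le_one] at hs
    have hd : HasFDerivAt f (fderiv 𝕜 f ((s : 𝕜) • v)) ((s : 𝕜) • v) :=
      ((hf _ (ofReal_smul_mem_ball hs hv)).differentiableAt (by simp)).hasFDerivAt
    have h1 : HasDerivAt (fun s : ℝ => f ((s : 𝕜) • v)) (fderiv 𝕜 f ((s : 𝕜) • v) v) s := by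
      have h2 : HasDerivAt (fun z : 𝕜 => f (z • v)) (fderiv 𝕜 f ((s : 𝕜) • v) ((1 : 𝕜) • v))
          (s : 𝕜) := hd.comp_hasDerivAt (s : 𝕜) ((hasDerivAt_id (s : 𝕜)).smul_const v)
      rw [one_smul] at h2
      have h3 : HasDerivAt (fun s : ℝ => (s : 𝕜)) (1 : 𝕜) s := by
        simpa using (RCLike.ofRealCLM (K := 𝕜)).hasDerivAt (x := s)
      simpa [Function.comp_def] using h2.scomp s h3
    simpa using h1

end RadialMean

universe u

-- Induction on `r`: the derivative of a mean is the mean, with weight one higher, of the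
-- derivative. Hence `m` and `G` must vary, and `G` shares the universe of `E` so that it may be
-- replaced by `E →L[𝕜] G`.
open Filter Metric in
theorem ContDiffFamilyAt.radialMean {𝕜 : Type} [RCLike 𝕜] {T : Type*} [TopologicalSpace T]
    {E : Type u} [NormedAddCommGroup E] [NormedSpace 𝕜 E] [ProperSpace E] {r : ℕ} :
    ∀ {G : Type u} [NormedAddCommGroup G] [NormedSpace ℝ G] [NormedSpace 𝕜 G]
      [SMulCommClass 𝕜 ℝ G] {f : T → E → G} {t : T} (_ : ContDiffFamilyAt 𝕜 r f t 0) (m : ℕ),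
      ContDiffFamilyAt 𝕜 r (fun s => radialMean 𝕜 m (f s)) t 0 := by
  induction r with
  | zero =>
    intro G _ _ _ _ f t h m
    obtain ⟨δ, hδ, h1⟩ := exists_ball_of_eventually h.1
    have h2 := h1.prod_nhds (ball_mem_nhds (0 : E) hδ)
    refine ⟨?_, fun j hj => ?_⟩
    · filter_upwards [h2] with q hq
      refine contDiffAt_zero.2 ⟨_, isOpen_ball.mem_nhds hq.2, fun y hy => ?_⟩
      exact (continuousAt_radialMean_of_ball (fun y hy => (hq.1 y hy).continuousAt) m
        hy).continuousWithinAt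
    · obtain rfl : j = 0 := by omega
      simp only [iteratedFDeriv_zero_eq_comp, Function.comp_apply]
      exact (continuousMultilinearCurryFin0 𝕜 E G).symm.continuous.continuousAt.comp
        (continuousAt_radialMean h.continuousAt (h.1.mono fun q hq => hq.continuousAt) m)
  | succ r ih =>
    intro G _ _ _ _ f t h m
    have h0 : ∀ᶠ q : T × E in 𝓝 (t, 0), ContDiffAt 𝕜 1 (f q.1) q.2 :=
      h.1.mono fun q hq => hq.of_le (by norm_cast; omega)
    obtain ⟨δ, hδ, h1⟩ := exists_ball_of_eventually h0
    have h2 : ∀ᶠ q : T × E in 𝓝 (t, 0), HasFDerivAt (ClassicalBlowup.radialMean 𝕜 m (f q.1))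
        (ClassicalBlowup.radialMean 𝕜 (m + 1) (_root_.fderiv 𝕜 (f q.1)) q.2) q.2 := by
      filter_upwards [h1.prod_nhds (ball_mem_nhds (0 : E) hδ)] with q hq
      exact hasFDerivAt_radialMean hq.1 m hq.2
    refine succ (continuousAt_radialMean h.continuousAt (h.1.mono fun q hq => hq.continuousAt) m)
      (h2.mono fun q hq => hq.differentiableAt) ?_
    exact (ih h.fderiv (m + 1)).congr (h2.mono fun q hq => hq.fderiv)

/-! ### Families of self-maps of a manifold -/

section ManifoldFamilies

open Filter

variable {𝕜 : Type} [RCLike 𝕜] {n : ℕ} {X : Type*} [TopologicalSpace X]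
  [ChartedSpace (Coord 𝕜 n) X] {T : Type*} [TopologicalSpace T]

/-- The self-maps `h s` of the manifold `X` form, in all charts of the atlas, a family of maps
which are `C^r` near `x` for all parameters `s` near `t`, with derivatives of order at most `r`
jointly continuous at `(t, x)`. -/
def ContMDiffFamilyAt (𝕜 : Type) [RCLike 𝕜] (n : ℕ) {X : Type*} [TopologicalSpace X]
    [ChartedSpace (Coord 𝕜 n) X] {T : Type*} [TopologicalSpace T] (r : ℕ) (h : T → X → X)
    (t : T) (x : X) : Prop :=
  ∀ e ∈ atlas (Coord 𝕜 n) X, ∀ e' ∈ atlas (Coord 𝕜 n) X, x ∈ e.source → h t x ∈ e'.source →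
    (∀ᶠ q : T × Coord 𝕜 n in 𝓝 (t, e x), h q.1 (e.symm q.2) ∈ e'.source) ∧
      ContDiffFamilyAt 𝕜 r (fun s => e' ∘ h s ∘ e.symm) t (e x)

omit [ChartedSpace (Coord 𝕜 n) X] in
theorem continuousAt_of_charts {h : T → X → X} {t : T} {x : X}
    {e e' : OpenPartialHomeomorph X (Coord 𝕜 n)} (hx : x ∈ e.source) (hx' : h t x ∈ e'.source)
    (hev : ∀ᶠ q : T × Coord 𝕜 n in 𝓝 (t, e x), h q.1 (e.symm q.2) ∈ e'.source)
    (hc : ContinuousAt (fun q : T × Coord 𝕜 n => e' (h q.1 (e.symm q.2))) (t, e x)) :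
    ContinuousAt (fun q : T × X => h q.1 q.2) (t, x) := by
  have hg : ContinuousAt (fun q : T × X => (q.1, e q.2)) (t, x) :=
    continuousAt_fst.prodMk ((e.continuousAt hx).comp_of_eq continuousAt_snd rfl)
  have h1 : ContinuousAt (fun q : T × X => e'.symm (e' (h q.1 (e.symm (e q.2))))) (t, x) := by
    have h2 : ContinuousAt (fun q : T × X => e' (h q.1 (e.symm (e q.2)))) (t, x) :=
      ContinuousAt.comp (f := fun q : T × X => (q.1, e q.2))
        (g := fun q : T × Coord 𝕜 n => e' (h q.1 (e.symm q.2))) hc hg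
    refine (e'.continuousAt_symm (x := e' (h t x)) (e'.map_source hx')).comp_of_eq h2 ?_
    simp only [e.left_inv hx]
  refine h1.congr ?_
  have hs : ∀ᶠ q : T × X in 𝓝 (t, x), q.2 ∈ e.source :=
    continuousAt_snd.eventually (e.open_source.mem_nhds hx)
  filter_upwards [hs, hg.eventually hev] with q h2 h3
  rw [e.left_inv h2] at h3 ⊢
  exact e'.left_inv h3

namespace ContMDiffFamilyAt

variable {r : ℕ} {h : T → X → X} {t : T} {x : X}

theorem of_le {m : ℕ} (H : ContMDiffFamilyAt 𝕜 n r h t x) (hm : m ≤ r) :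
    ContMDiffFamilyAt 𝕜 n m h t x :=
  fun e he e' he' hx hx' => ⟨(H e he e' he' hx hx').1, (H e he e' he' hx hx').2.of_le hm⟩

theorem continuousAt (H : ContMDiffFamilyAt 𝕜 n r h t x) :
    ContinuousAt (fun q : T × X => h q.1 q.2) (t, x) := by
  obtain ⟨h1, h2⟩ := H (chartAt _ x) (chart_mem_atlas _ x) (chartAt _ (h t x))
    (chart_mem_atlas _ _) (mem_chart_source _ x) (mem_chart_source _ _)
  exact continuousAt_of_charts (mem_chart_source _ x) (mem_chart_source _ _) h1 h2.continuousAt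

/-- Any other pair of charts conjugates the local expression by coordinate changes, which are
constant `C^r` families; so one pair of charts suffices. -/
theorem of_charts [IsManifold 𝓘(𝕜, Coord 𝕜 n) r X]
    {e e' : OpenPartialHomeomorph X (Coord 𝕜 n)} (he : e ∈ atlas (Coord 𝕜 n) X)
    (he' : e' ∈ atlas (Coord 𝕜 n) X) (hx : x ∈ e.source) (hx' : h t x ∈ e'.source)
    (hev : ∀ᶠ q : T × Coord 𝕜 n in 𝓝 (t, e x), h q.1 (e.symm q.2) ∈ e'.source)
    (hf : ContDiffFamilyAt 𝕜 r (fun s => e' ∘ h s ∘ e.symm) t (e x)) :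
    ContMDiffFamilyAt 𝕜 n r h t x := by
  intro c hc c' hc' hxc hxc'
  have hcont := continuousAt_of_charts hx hx' hev hf.continuousAt
  have hcx : c.symm (c x) = x := c.left_inv hxc
  have hg : ContinuousAt (fun q : T × Coord 𝕜 n => (q.1, c.symm q.2)) (t, c x) :=
    continuousAt_fst.prodMk
      ((c.continuousAt_symm (c.map_source hxc)).comp_of_eq continuousAt_snd rfl)
  have hcont' : ContinuousAt (fun q : T × Coord 𝕜 n => h q.1 (c.symm q.2)) (t, c x) :=
    ContinuousAt.comp_of_eq (f := fun q : T × Coord 𝕜 n => (q.1, c.symm q.2)) hcont hg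
      (by simp only [hcx])
  have hev1 : ∀ᶠ q : T × Coord 𝕜 n in 𝓝 (t, c x), h q.1 (c.symm q.2) ∈ c'.source :=
    hcont'.eventually (c'.open_source.mem_nhds (by simpa only [hcx] using hxc'))
  refine ⟨hev1, ?_⟩
  have hev2 : ∀ᶠ q : T × Coord 𝕜 n in 𝓝 (t, c x), h q.1 (c.symm q.2) ∈ e'.source :=
    hcont'.eventually (e'.open_source.mem_nhds (by simpa only [hcx] using hx'))
  have hev3 : ∀ᶠ q : T × Coord 𝕜 n in 𝓝 (t, c x), c.symm q.2 ∈ e.source :=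
    hg.snd.eventually (e.open_source.mem_nhds (by simpa only [hcx] using hx))
  have k1 : ContDiffAt 𝕜 r (fun w => e (c.symm w)) (c x) :=
    contDiffAt_coordChange hc he (c.map_source hxc) (by rwa [hcx])
  have k2 : ContDiffAt 𝕜 r (fun w => c' (e'.symm w)) (e' (h t x)) :=
    contDiffAt_coordChange he' hc' (e'.map_source hx') (by rwa [e'.left_inv hx'])
  have k3 : ContDiffFamilyAt 𝕜 r (fun s => (e' ∘ h s ∘ e.symm) ∘ fun w => e (c.symm w)) t
      (c x) := by
    refine ContDiffFamilyAt.comp (f := fun _ w => e (c.symm w)) ?_ (.const k1 t)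
    simpa only [hcx] using hf
  have k4 := ContDiffFamilyAt.postcomp (g := fun w => c' (e'.symm w)) (by
    simpa only [Function.comp_apply, hcx, e.left_inv hx] using k2) k3
  refine k4.congr ?_
  filter_upwards [hev2, hev3] with q h2 h3
  simp only [Function.comp_apply, e.left_inv h3, e'.left_inv h2]

theorem contMDiffAt [IsManifold 𝓘(𝕜, Coord 𝕜 n) r X] (H : ContMDiffFamilyAt 𝕜 n r h t x) :
    ContMDiffAt 𝓘(𝕜, Coord 𝕜 n) 𝓘(𝕜, Coord 𝕜 n) r (h t) x := by
  rw [contMDiffAt_iff_of_mem_maximalAtlas (IsManifold.chart_mem_maximalAtlas x)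
    (IsManifold.chart_mem_maximalAtlas (h t x)) (mem_chart_source _ x) (mem_chart_source _ _)]
  refine ⟨H.continuousAt.comp (f := fun y : X => (t, y)) (by fun_prop), ?_⟩
  exact (H _ (chart_mem_atlas _ x) _ (chart_mem_atlas _ (h t x)) (mem_chart_source _ x)
    (mem_chart_source _ _)).2.contDiffAt.contDiffWithinAt

/-- Over a one-point parameter space this makes the regularity of a single map an instance of the
statements on families. -/
theorem const [IsManifold 𝓘(𝕜, Coord 𝕜 n) r X] {g : X → X}
    (hg : ContMDiffAt 𝓘(𝕜, Coord 𝕜 n) 𝓘(𝕜, Coord 𝕜 n) r g x) (t : T) :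
    ContMDiffFamilyAt 𝕜 n r (fun _ => g) t x := by
  intro e he e' he' hx hx'
  obtain ⟨h1, h2⟩ := (contMDiffAt_iff_of_mem_maximalAtlas
    (IsManifold.subset_maximalAtlas he) (IsManifold.subset_maximalAtlas he') hx hx').1 hg
  refine ⟨?_, .const ?_ t⟩
  · have h3 : ContinuousAt (fun q : T × Coord 𝕜 n => g (e.symm q.2)) (t, e x) := by
      have h4 : ContinuousAt (fun w => g (e.symm w)) (e x) :=
        h1.comp_of_eq (e.continuousAt_symm (e.map_source hx)) (e.left_inv hx)
      exact h4.comp_of_eq continuousAt_snd rfl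
    exact h3.eventually (e'.open_source.mem_nhds (by simpa only [e.left_inv hx] using hx'))
  · simpa [ModelWithCorners.range_eq_univ, contDiffWithinAt_univ] using h2

end ContMDiffFamilyAt

end ManifoldFamilies

/-! ### The induced map and its expression in affine charts -/

section BlowupMap

open Filter

variable {𝕜 : Type} [RCLike 𝕜] {n : ℕ} {M : Type*} [TopologicalSpace M]
  [ChartedSpace (Coord 𝕜 n) M]

/-- The derivative of `h` at `p`, as an endomorphism of the coordinate space. -/
noncomputable def derivAt (𝕜 : Type) [RCLike 𝕜] (n : ℕ) {M : Type*} [TopologicalSpace M]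
    [ChartedSpace (Coord 𝕜 n) M] (h : M → M) (p : M) : Coord 𝕜 n →L[𝕜] Coord 𝕜 n :=
  mfderiv 𝓘(𝕜, Coord 𝕜 n) 𝓘(𝕜, Coord 𝕜 n) h p

/-- The manifold derivative is computed in the preferred charts at `p` and at `h p = p`, which
coincide; centring composes with translations, whose derivative is the identity. -/
theorem derivAt_eq_fderiv {h : M → M} {p : M} (hp : h p = p)
    (hd : MDifferentiableAt 𝓘(𝕜, Coord 𝕜 n) 𝓘(𝕜, Coord 𝕜 n) h p) :
    derivAt 𝕜 n h p = fderiv 𝕜 (fun v => centred 𝕜 n p (h (uncentred 𝕜 n p v))) 0 := by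
  have h1 : derivAt 𝕜 n h p = fderivWithin 𝕜
      (writtenInExtChartAt 𝓘(𝕜, Coord 𝕜 n) 𝓘(𝕜, Coord 𝕜 n) p h)
      (range 𝓘(𝕜, Coord 𝕜 n)) (extChartAt 𝓘(𝕜, Coord 𝕜 n) p p) := hd.mfderiv
  have h2 : writtenInExtChartAt 𝓘(𝕜, Coord 𝕜 n) 𝓘(𝕜, Coord 𝕜 n) p h =
      fun v => chartAt (Coord 𝕜 n) p (h ((chartAt (Coord 𝕜 n) p).symm v)) := by
    ext1 v
    simp [writtenInExtChartAt, hp]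
  rw [h1, h2, modelWithCornersSelf_coe, range_id, fderivWithin_univ]
  simp only [centred, uncentred, fderiv_sub_const]
  rw [fderiv_comp_add_left (f := fun v =>
    chartAt (Coord 𝕜 n) p (h ((chartAt (Coord 𝕜 n) p).symm v))), add_zero]
  simp

theorem derivAt_comp {g h : M → M} {p : M} (hp : h p = p)
    (hg : MDifferentiableAt 𝓘(𝕜, Coord 𝕜 n) 𝓘(𝕜, Coord 𝕜 n) g p)
    (hh : MDifferentiableAt 𝓘(𝕜, Coord 𝕜 n) 𝓘(𝕜, Coord 𝕜 n) h p) :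
    derivAt 𝕜 n (g ∘ h) p = (derivAt 𝕜 n g p).comp (derivAt 𝕜 n h p) := by
  have h1 : derivAt 𝕜 n (g ∘ h) p = (derivAt 𝕜 n g (h p)).comp (derivAt 𝕜 n h p) :=
    mfderiv_comp p (by rwa [hp]) hh
  rw [h1, hp]

theorem derivAt_id (p : M) : derivAt 𝕜 n (id : M → M) p = ContinuousLinearMap.id 𝕜 _ :=
  mfderiv_id

open Classical in
/-- The map of the blowup induced by `h`. It takes default values where `h` or its derivative at
`p` is not injective. -/
noncomputable def blowupMap (𝕜 : Type) [RCLike 𝕜] (n : ℕ) {M : Type*} [TopologicalSpace M]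
    [ChartedSpace (Coord 𝕜 n) M] (p : M) (h : M → M) : Blowup 𝕜 n p → Blowup 𝕜 n p
  | .off x hx => if hy : h x = p then .off x hx else .off (h x) hy
  | .exc L => if hw : derivAt 𝕜 n h p L.rep = 0 then .exc L
      else .exc (Projectivization.mk 𝕜 (derivAt 𝕜 n h p L.rep) hw)

theorem exc_mk_congr {p : M} {v w : Coord 𝕜 n} (h : v = w) (hv : v ≠ 0) (hw : w ≠ 0) :
    (Blowup.exc (Projectivization.mk 𝕜 v hv) : Blowup 𝕜 n p) =
      .exc (Projectivization.mk 𝕜 w hw) := by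
  subst h; rfl

variable [T1Space M] {p : M} {h : M → M} {h' : Blowup 𝕜 n p → Blowup 𝕜 n p}

/-- The chosen representative of a line is a nonzero multiple of any spanning vector, so linearity
makes the image line independent of the choice. -/
theorem isBlowupMap_blowupMap (hp : ∀ x, x ≠ p → h x ≠ p)
    (hD : Function.Injective (derivAt 𝕜 n h p)) : IsBlowupMap h (blowupMap 𝕜 n p h) where
  off x hx := ⟨hp x hx, dif_neg (hp x hx)⟩
  exc v hv := by
    have hne : ∀ w : Coord 𝕜 n, w ≠ 0 → derivAt 𝕜 n h p w ≠ 0 := fun w hw h0 =>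
      hw (hD (h0.trans (map_zero _).symm))
    refine ⟨hne v hv, ?_⟩
    have h1 := hne _ (Projectivization.mk 𝕜 v hv).rep_nonzero
    refine (dif_neg h1).trans (congrArg Blowup.exc ?_)
    obtain ⟨a, ha⟩ := Projectivization.exists_smul_eq_mk_rep 𝕜 v hv
    refine (Projectivization.mk_eq_mk_iff' 𝕜 _ _ h1 (hne v hv)).2 ⟨a, ?_⟩
    rw [← ha]
    exact ((derivAt 𝕜 n h p).map_smul (a : 𝕜) v).symm

namespace IsBlowupMap

theorem exc_derivAt (H : IsBlowupMap h h') {v : Coord 𝕜 n} (hv : v ≠ 0) :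
    ∃ hw : derivAt 𝕜 n h p v ≠ 0, h' (.exc (Projectivization.mk 𝕜 v hv)) =
      .exc (Projectivization.mk 𝕜 (derivAt 𝕜 n h p v) hw) :=
  H.exc v hv

/-- The defining relations prescribe the value at every point. Identities between lifts thus follow
by checking that both sides satisfy the same relations. -/
theorem unique {h'' : Blowup 𝕜 n p → Blowup 𝕜 n p} (H : IsBlowupMap h h')
    (H' : IsBlowupMap h h'') : h' = h'' := by
  funext z
  cases z with
  | off x hx =>
    obtain ⟨_, h1⟩ := H.off x hx
    obtain ⟨_, h2⟩ := H'.off x hx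
    rw [h1, h2]
  | exc L =>
    induction L with
    | h v hv =>
      obtain ⟨_, h1⟩ := H.exc v hv
      obtain ⟨_, h2⟩ := H'.exc v hv
      rw [h1, h2]

theorem id : IsBlowupMap (_root_.id : M → M) (_root_.id : Blowup 𝕜 n p → Blowup 𝕜 n p) where
  off _ hx := ⟨hx, rfl⟩
  exc v hv := by
    have h1 : derivAt 𝕜 n (_root_.id : M → M) p v = v := by rw [derivAt_id]; rfl
    have h2 : derivAt 𝕜 n (_root_.id : M → M) p v ≠ 0 := by rwa [h1]
    exact ⟨h2, exc_mk_congr h1.symm hv h2⟩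

theorem comp {g : M → M} {g' : Blowup 𝕜 n p → Blowup 𝕜 n p} (hp : h p = p)
    (hg : MDifferentiableAt 𝓘(𝕜, Coord 𝕜 n) 𝓘(𝕜, Coord 𝕜 n) g p)
    (hh : MDifferentiableAt 𝓘(𝕜, Coord 𝕜 n) 𝓘(𝕜, Coord 𝕜 n) h p)
    (G : IsBlowupMap g g') (H : IsBlowupMap h h') : IsBlowupMap (g ∘ h) (g' ∘ h') where
  off x hx := by
    obtain ⟨h1, h2⟩ := H.off x hx
    obtain ⟨h3, h4⟩ := G.off (h x) h1
    exact ⟨h3, (congrArg g' h2).trans h4⟩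
  exc v hv := by
    obtain ⟨h1, h2⟩ := H.exc_derivAt hv
    obtain ⟨h3, h4⟩ := G.exc_derivAt h1
    have h5 : derivAt 𝕜 n (g ∘ h) p v = derivAt 𝕜 n g p (derivAt 𝕜 n h p v) := by
      rw [derivAt_comp hp hg hh]; rfl
    have h6 : derivAt 𝕜 n (g ∘ h) p v ≠ 0 := by rwa [h5]
    exact ⟨h6, ((congrArg g' h2).trans h4).trans (exc_mk_congr h5.symm h3 h6)⟩

theorem blowdown_apply (H : IsBlowupMap h h') (hp : h p = p) (z : Blowup 𝕜 n p) :
    blowdown (h' z) = h (blowdown z) := by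
  cases z with
  | off x hx =>
    obtain ⟨_, h1⟩ := H.off x hx
    rw [h1]; rfl
  | exc L =>
    induction L with
    | h v hv =>
      obtain ⟨_, h1⟩ := H.exc v hv
      rw [h1]; exact hp.symm

end IsBlowupMap

/-- The coordinate expression `(A, u) ↦ (u_i (A d)_j, (A d)_l / (A d)_j)`, where `d` is obtained
from `u` by replacing `u_i` by `1`. -/
noncomputable def linearChange (i j : Fin n)
    (q : (Coord 𝕜 n →L[𝕜] Coord 𝕜 n) × Coord 𝕜 n) : Coord 𝕜 n :=
  WithLp.toLp 2 (fun l => if l = j then q.2 i * q.1 (dir i q.2) j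
    else q.1 (dir i q.2) l / q.1 (dir i q.2) j)

theorem contDiff_dir (m : WithTop ℕ∞) (i : Fin n) : ContDiff 𝕜 m (dir (𝕜 := 𝕜) i) := by
  rw [contDiff_euclidean]
  intro l
  by_cases hl : l = i
  · simp [hl]; fun_prop
  · simp [hl]; fun_prop

theorem contDiffAt_linearChange (m : WithTop ℕ∞) (i j : Fin n)
    {q : (Coord 𝕜 n →L[𝕜] Coord 𝕜 n) × Coord 𝕜 n} (hq : q.1 (dir i q.2) j ≠ 0) :
    ContDiffAt 𝕜 m (linearChange i j) q := by
  have h1 : ∀ l, ContDiff 𝕜 m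
      (fun q : (Coord 𝕜 n →L[𝕜] Coord 𝕜 n) × Coord 𝕜 n => q.1 (dir i q.2) l) := fun l =>
    contDiff_euclidean.1 (contDiff_fst.clm_apply ((contDiff_dir m i).comp contDiff_snd)) l
  rw [contDiffAt_euclidean]
  intro l
  by_cases hl : l = j
  · simp only [linearChange, hl, if_true]
    exact ContDiffAt.mul (by fun_prop) (h1 j).contDiffAt
  · simp only [linearChange, hl, if_false]
    exact (h1 l).contDiffAt.div (h1 j).contDiffAt hq

theorem affineCoord_smul (j : Fin n) {a : 𝕜} (ha : a ≠ 0) (w : Coord 𝕜 n) (l : Fin n) :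
    affineCoord j (a • w) l = if l = j then a * w j else w l / w j := by
  simp only [affineCoord_apply, PiLp.smul_apply, smul_eq_mul]
  rw [mul_div_mul_left _ _ ha]

omit [T1Space M] in
open Classical in
theorem excChart_symm_of_ne {i : Fin n} {u : Coord 𝕜 n}
    (hu : uncentred 𝕜 n p (u i • dir i u) ≠ p) :
    (excChart p i).symm u = .off (uncentred 𝕜 n p (u i • dir i u)) hu :=
  dif_neg hu

omit [T1Space M] in
open Classical in
theorem excChart_symm_of_zero {i : Fin n} {u : Coord 𝕜 n} (hu : u i = 0) :
    (excChart p i).symm u = .exc (Projectivization.mk 𝕜 (dir i u) (dir_ne_zero i u)) :=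
  dif_pos (by rw [hu, zero_smul, uncentred_zero])

/-- The central computation. At a point with `v = u_i d` it needs only a linear map `A` sending `v`
to the centred coordinate of the image. If `u_i ≠ 0`, that image is `u_i • A d` and `u_i` cancels in
the quotients of coordinates. If `u_i = 0`, the image is the line spanned by `A d`, because `A` is
then the derivative at `p`. -/
theorem IsBlowupMap.excChart_apply (H : IsBlowupMap h h') (i j : Fin n) {u : Coord 𝕜 n}
    (hu : u ∈ (excChart p i).target) {A : Coord 𝕜 n →L[𝕜] Coord 𝕜 n}
    (hsrc : h (uncentred 𝕜 n p (u i • dir i u)) ∈ (chartAt (Coord 𝕜 n) p).source)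
    (hA : centred 𝕜 n p (h (uncentred 𝕜 n p (u i • dir i u))) = A (u i • dir i u))
    (hD : u i = 0 → A = derivAt 𝕜 n h p) (hj : A (dir i u) j ≠ 0) :
    h' ((excChart p i).symm u) ∈ (excChart p j).source ∧
      excChart p j (h' ((excChart p i).symm u)) = linearChange i j (A, u) := by
  by_cases h0 : u i = 0
  · have hAD := hD h0
    subst hAD
    rw [excChart_symm_of_zero h0]
    obtain ⟨h1, h2⟩ := H.exc_derivAt (dir_ne_zero i u)
    rw [h2]
    refine ⟨?_, ?_⟩
    · obtain ⟨a, ha, hr⟩ := exists_rep_mk _ h1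
      exact (hr j).trans_ne (mul_ne_zero ha hj)
    · ext l
      refine (lineCoord_mk j _ h1 l).trans ?_
      simp [linearChange, h0]
  · have hne : uncentred 𝕜 n p (u i • dir i u) ≠ p := fun h1 =>
      h0 ((smul_dir_eq_zero i u).1 ((uncentred_eq_iff p _ hu).1 h1))
    rw [excChart_symm_of_ne hne]
    obtain ⟨h1, h2⟩ := H.off _ hne
    rw [h2]
    rw [map_smul] at hA
    refine ⟨⟨hsrc, ?_⟩, ?_⟩
    · rw [hA]
      exact mul_ne_zero h0 hj
    · ext l
      change affineCoord j (centred 𝕜 n p _) l = _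
      rw [hA, affineCoord_smul j h0]
      rfl

/-- The index `i` is a nonzero coordinate of the line and `j` a nonzero coordinate of its image; the
latter makes the denominator in `linearChange` nonzero. -/
theorem IsBlowupMap.exists_chart (H : IsBlowupMap h h') (L : ℙ 𝕜 (Coord 𝕜 n)) :
    ∃ i j, (Blowup.exc L : Blowup 𝕜 n p) ∈ (excChart (𝕜 := 𝕜) p i).source ∧
      h' (.exc L) ∈ (excChart (𝕜 := 𝕜) p j).source ∧
      derivAt 𝕜 n h p (dir i (excChart p i (.exc L : Blowup 𝕜 n p))) j ≠ 0 := by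
  obtain ⟨i, hi⟩ := exists_rep_ne_zero L
  obtain ⟨h1, h2⟩ := H.exc_derivAt (dir_ne_zero i (lineCoord i L))
  rw [mk_dir_lineCoord i L hi] at h2
  obtain ⟨j, hj⟩ := exists_rep_ne_zero (Projectivization.mk 𝕜 _ h1)
  refine ⟨i, j, hi, ?_, ?_⟩
  · rw [h2]; exact hj
  · obtain ⟨a, ha, hr⟩ := exists_rep_mk _ h1
    rw [hr] at hj
    exact right_ne_zero_of_mul hj

/-- A partial equivalence of the blowup atlas, as a chart of the blowup. -/
noncomputable def blowupChart {c : PartialEquiv (Blowup 𝕜 n p) (Coord 𝕜 n)}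
    (hc : c ∈ blowupAtlas 𝕜 n p) : OpenPartialHomeomorph (Blowup 𝕜 n p) (Coord 𝕜 n) :=
  (blowupCore 𝕜 n p).openPartialHomeomorph c hc

theorem blowupChart_mem_atlas {c : PartialEquiv (Blowup 𝕜 n p) (Coord 𝕜 n)}
    (hc : c ∈ blowupAtlas 𝕜 n p) : blowupChart hc ∈ atlas (Coord 𝕜 n) (Blowup 𝕜 n p) := by
  change blowupChart hc ∈ ⋃ (c : PartialEquiv (Blowup 𝕜 n p) (Coord 𝕜 n))
    (hc : c ∈ (blowupCore 𝕜 n p).atlas), {(blowupCore 𝕜 n p).openPartialHomeomorph c hc}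
  simp only [mem_iUnion, mem_singleton_iff]
  exact ⟨c, hc, rfl⟩

omit [T1Space M] in
theorem excChart_mem_blowupAtlas (p : M) (i : Fin n) :
    excChart (𝕜 := 𝕜) p i ∈ blowupAtlas 𝕜 n p := Or.inr ⟨i, rfl⟩

omit [T1Space M] in
theorem offChart_mem_blowupAtlas (z : Blowup 𝕜 n p) (x : M) :
    offChart z (chartAt (Coord 𝕜 n) x) ∈ blowupAtlas 𝕜 n p :=
  Or.inl ⟨z, _, chart_mem_atlas _ x, rfl⟩

end BlowupMap

/-! ### Regularity of the lifted families -/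

section BlowupFamilies

open Filter

variable {𝕜 : Type} [RCLike 𝕜] {n : ℕ} {M : Type*} [TopologicalSpace M] [T1Space M]
  [ChartedSpace (Coord 𝕜 n) M] {T : Type*} [TopologicalSpace T] {p : M}

/-- Charts away from the exceptional locus are charts of `M` composed with the blowdown, which
intertwines `h'` and `h`. The local expressions agree and no order is lost. -/
theorem ContMDiffFamilyAt.blowup_off {r : ℕ} [IsManifold 𝓘(𝕜, Coord 𝕜 n) r M]
    {h : T → M → M} {h' : T → Blowup 𝕜 n p → Blowup 𝕜 n p}
    (H : ∀ s, IsBlowupMap (h s) (h' s)) (hp : ∀ s, h s p = p) {t : T} {x : M} (hx : x ≠ p)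
    (F : ContMDiffFamilyAt 𝕜 n r h t x) : ContMDiffFamilyAt 𝕜 n r h' t (.off x hx) := by
  obtain ⟨h1, h2⟩ := H t |>.off x hx
  obtain ⟨hev, hf⟩ := F (chartAt _ x) (chart_mem_atlas _ x) (chartAt _ (h t x))
    (chart_mem_atlas _ _) (mem_chart_source _ x) (mem_chart_source _ _)
  set φ := chartAt (Coord 𝕜 n) x
  set ψ := chartAt (Coord 𝕜 n) (h t x)
  have hxφ : φ.symm (φ x) = x := φ.left_inv (mem_chart_source _ x)
  have hw : ∀ᶠ w in 𝓝 (φ x), φ.symm w ≠ p :=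
    (eventually_symm_mem (φ.map_source (mem_chart_source _ x))
      isOpen_compl_singleton (by rwa [hxφ])).mono fun w hw => hw.2
  have hne : ∀ᶠ q : T × Coord 𝕜 n in 𝓝 (t, φ x), φ.symm q.2 ≠ p :=
    Tendsto.eventually (p := fun w => φ.symm w ≠ p) (continuous_snd.tendsto (t, φ x)) hw
  have hoff : ∀ q : T × Coord 𝕜 n, φ.symm q.2 ≠ p →
      blowdown (h' q.1 ((offChart (.off x hx) φ).symm q.2)) = h q.1 (φ.symm q.2) ∧
      blowdown (h' q.1 ((offChart (.off x hx) φ).symm q.2)) ≠ p := by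
    intro q hq
    rw [offChart_symm _ φ hq, (H q.1).blowdown_apply (hp q.1)]
    exact ⟨rfl, ((H q.1).off _ hq).1⟩
  refine .of_charts (blowupChart_mem_atlas (offChart_mem_blowupAtlas (.off x hx) x))
    (blowupChart_mem_atlas (offChart_mem_blowupAtlas (.off x hx) (h t x)))
    ⟨hx, mem_chart_source _ x⟩ ?_ ?_ ?_
  · rw [h2]
    exact ⟨h1, mem_chart_source _ _⟩
  · filter_upwards [hev, hne] with q hq hq'
    obtain ⟨h3, h4⟩ := hoff q hq'
    exact ⟨h4, by rw [← h3] at hq; exact hq⟩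
  · refine hf.congr ?_
    filter_upwards [hne] with q hq'
    exact congrArg ψ (hoff q hq').1

/-- The same comparison for a single map, but at an arbitrary order, including `∞` and `ω`, which
families of finite order do not reach directly. -/
theorem contMDiffAt_blowup_off {m : WithTop ℕ∞} [IsManifold 𝓘(𝕜, Coord 𝕜 n) m M]
    {h : M → M} {h' : Blowup 𝕜 n p → Blowup 𝕜 n p} (H : IsBlowupMap h h') (hp : h p = p)
    {x : M} (hx : x ≠ p) (hd : ContMDiffAt 𝓘(𝕜, Coord 𝕜 n) 𝓘(𝕜, Coord 𝕜 n) m h x) :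
    ContMDiffAt 𝓘(𝕜, Coord 𝕜 n) 𝓘(𝕜, Coord 𝕜 n) m h' (.off x hx) := by
  have : IsManifold 𝓘(𝕜, Coord 𝕜 n) ((0 : ℕ) : WithTop ℕ∞) M := .of_le (n := m) (by simp)
  have hcont : ContinuousAt h' (.off x hx) :=
    (ContMDiffFamilyAt.blowup_off (T := Unit) (h := fun _ => h) (h' := fun _ => h') (r := 0)
      (fun _ => H) (fun _ => hp) hx (.const (hd.of_le (by simp)) ())).contMDiffAt.continuousAt
  obtain ⟨h1, h2⟩ := H.off x hx
  have hmem := offChart_mem_blowupAtlas (𝕜 := 𝕜) (.off x hx : Blowup 𝕜 n p)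
  have hd' := ((contMDiffAt_iff_of_mem_maximalAtlas
    (IsManifold.chart_mem_maximalAtlas x) (IsManifold.chart_mem_maximalAtlas (h x))
    (mem_chart_source _ x) (mem_chart_source _ (h x))).1 hd).2
  rw [contMDiffAt_iff_of_mem_maximalAtlas
    (x := .off x hx) (e := blowupChart (hmem x)) (e' := blowupChart (hmem (h x)))
    (IsManifold.subset_maximalAtlas (blowupChart_mem_atlas _))
    (IsManifold.subset_maximalAtlas (blowupChart_mem_atlas _))
    ⟨hx, mem_chart_source _ x⟩ (by rw [h2]; exact ⟨h1, mem_chart_source _ _⟩)]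
  refine ⟨hcont, ?_⟩
  rw [ModelWithCorners.range_eq_univ, contDiffWithinAt_univ] at hd' ⊢
  set φ := chartAt (Coord 𝕜 n) x
  have hxφ : φ.symm (φ x) = x := φ.left_inv (mem_chart_source _ x)
  refine hd'.congr_of_eventuallyEq ?_
  filter_upwards [eventually_symm_mem (φ.map_source (mem_chart_source _ x))
    isOpen_compl_singleton (by rwa [hxφ])] with w hw
  change chartAt (Coord 𝕜 n) (h x) (blowdown (h' ((offChart (.off x hx) φ).symm w))) =
    chartAt (Coord 𝕜 n) (h x) (h (φ.symm w))
  rw [offChart_symm _ φ hw.2, H.blowdown_apply hp]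
  rfl

omit [T1Space M] in
theorem excChart_exc_apply_self (i : Fin n) (L : ℙ 𝕜 (Coord 𝕜 n)) :
    excChart p i (.exc L : Blowup 𝕜 n p) i = 0 := by
  change lineCoord i L i = 0
  simp

omit [T1Space M] in
theorem isOpen_centredTarget (p : M) : IsOpen (centredTarget 𝕜 n p) :=
  (chartAt (Coord 𝕜 n) p).open_target.preimage (continuous_const.add continuous_id)

omit [T1Space M] in
theorem zero_mem_centredTarget (p : M) : (0 : Coord 𝕜 n) ∈ centredTarget 𝕜 n p := by
  simp [centredTarget]

omit [T1Space M] in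
theorem ContMDiffFamilyAt.centred {r : ℕ} {h : T → M → M} (hp : ∀ s, h s p = p) {t : T}
    (F : ContMDiffFamilyAt 𝕜 n r h t p) :
    (∀ᶠ q : T × Coord 𝕜 n in 𝓝 (t, 0), h q.1 (uncentred 𝕜 n p q.2) ∈
      (chartAt (Coord 𝕜 n) p).source) ∧
    ContDiffFamilyAt 𝕜 r (fun s v => centred 𝕜 n p (h s (uncentred 𝕜 n p v))) t 0 := by
  obtain ⟨hev, hf⟩ := F (chartAt _ p) (chart_mem_atlas _ p) (chartAt _ p)
    (chart_mem_atlas _ _) (mem_chart_source _ p) (by rw [hp]; exact mem_chart_source _ _)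
  set φ := chartAt (Coord 𝕜 n) p
  refine ⟨?_, ?_⟩
  · have hc : ContinuousAt (fun q : T × Coord 𝕜 n => (q.1, φ p + q.2)) (t, 0) := by fun_prop
    have hc' : Tendsto (fun q : T × Coord 𝕜 n => (q.1, φ p + q.2)) (𝓝 (t, 0)) (𝓝 (t, φ p)) := by
      simpa using hc.tendsto
    exact hc'.eventually hev
  · have h1 : ContDiffFamilyAt 𝕜 r (fun s => (φ ∘ h s ∘ φ.symm) ∘ fun v => φ p + v) t 0 := by
      refine ContDiffFamilyAt.comp (f := fun _ v => φ p + v) ?_ (.const (by fun_prop) t)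
      simpa using hf
    exact h1.postcomp (g := fun w => w - φ p) (by fun_prop)

/-- If the maps `h s` form a `C^(r+1)` family at `p`, then the induced maps of the blowup form a
`C^r` family at the points of the exceptional locus. -/
theorem ContMDiffFamilyAt.blowup_exc {r : ℕ} [IsManifold 𝓘(𝕜, Coord 𝕜 n) r M]
    {h : T → M → M} {h' : T → Blowup 𝕜 n p → Blowup 𝕜 n p}
    (H : ∀ s, IsBlowupMap (h s) (h' s)) (hp : ∀ s, h s p = p)
    (hd : ∀ s, MDifferentiableAt 𝓘(𝕜, Coord 𝕜 n) 𝓘(𝕜, Coord 𝕜 n) (h s) p) {t : T}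
    (L : ℙ 𝕜 (Coord 𝕜 n))
    (F : ContMDiffFamilyAt 𝕜 n (r + 1) h t p) : ContMDiffFamilyAt 𝕜 n r h' t (.exc L) := by
  obtain ⟨hsrc, hG⟩ := F.centred hp
  set G : T → Coord 𝕜 n → Coord 𝕜 n :=
    fun s v => ClassicalBlowup.centred 𝕜 n p (h s (uncentred 𝕜 n p v)) with hGdef
  -- The one loss of order: the Hadamard factor is a mean of the derivative of `G`.
  have hA : ContDiffFamilyAt 𝕜 r (fun s => radialMean 𝕜 0 (fderiv 𝕜 (G s))) t 0 :=
    hG.fderiv.radialMean 0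
  have hA0 : ∀ s, radialMean 𝕜 0 (fderiv 𝕜 (G s)) 0 = derivAt 𝕜 n (h s) p := fun s => by
    rw [radialMean_zero, derivAt_eq_fderiv (hp s) (hd s)]
  have hGA : ∀ᶠ q : T × Coord 𝕜 n in 𝓝 (t, 0),
      G q.1 q.2 = radialMean 𝕜 0 (fderiv 𝕜 (G q.1)) q.2 q.2 := by
    have h0 : ∀ᶠ q : T × Coord 𝕜 n in 𝓝 (t, 0), ContDiffAt 𝕜 1 (G q.1) q.2 :=
      hG.1.mono fun q hq => hq.of_le (by norm_cast; omega)
    obtain ⟨δ, hδ, h1⟩ := exists_ball_of_eventually h0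
    filter_upwards [h1.prod_nhds (Metric.ball_mem_nhds (0 : Coord 𝕜 n) hδ)] with q hq
    rw [radialMean_fderiv_apply hq.1 hq.2]
    simp [hGdef, uncentred_zero, hp, ClassicalBlowup.centred]
  set A : T → Coord 𝕜 n → Coord 𝕜 n →L[𝕜] Coord 𝕜 n :=
    fun s => radialMean 𝕜 0 (fderiv 𝕜 (G s))
  obtain ⟨i, j, hi, hj, hij⟩ := (H t).exists_chart L
  set u₀ : Coord 𝕜 n := excChart p i (.exc L : Blowup 𝕜 n p) with hu₀
  -- A point of the exceptional locus has `u_i = 0`, so regularity of `A` is needed only at the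
  -- origin.
  have hu₀i : u₀ i • dir i u₀ = 0 := by rw [hu₀, excChart_exc_apply_self, zero_smul]
  have hsm : ContDiff 𝕜 r (fun u : Coord 𝕜 n => u i • dir i u) := contDiff_smul_dir _ i
  have hB : ContDiffFamilyAt 𝕜 r (fun s u => (A s (u i • dir i u), u)) t u₀ := by
    refine ContDiffFamilyAt.prodMk ?_ (.const contDiffAt_id t)
    refine ContDiffFamilyAt.comp (g := A) (f := fun _ u => u i • dir i u) ?_
      (.const hsm.contDiffAt t)
    rwa [hu₀i]
  have hB0 : ((A t (u₀ i • dir i u₀), u₀) : (Coord 𝕜 n →L[𝕜] Coord 𝕜 n) × Coord 𝕜 n).1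
      (dir i u₀) j ≠ 0 := by
    rw [hu₀i]
    change A t 0 (dir i u₀) j ≠ 0
    rwa [show A t 0 = derivAt 𝕜 n (h t) p from hA0 t]
  have hΨ := ContDiffFamilyAt.postcomp (f := fun s u => (A s (u i • dir i u), u))
    (contDiffAt_linearChange r i j hB0) hB
  have hj' : ∀ᶠ q : T × Coord 𝕜 n in 𝓝 (t, u₀),
      A q.1 (q.2 i • dir i q.2) (dir i q.2) j ≠ 0 := by
    have h1 := hB.continuousAt
    have h2 : Continuous (fun q : (Coord 𝕜 n →L[𝕜] Coord 𝕜 n) × Coord 𝕜 n =>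
        q.1 (dir i q.2) j) := by
      have := (contDiff_dir (𝕜 := 𝕜) 0 i).continuous
      fun_prop
    exact (h2.continuousAt.comp h1).eventually_ne hB0
  have hsm0 : Tendsto (fun q : T × Coord 𝕜 n => (q.1, q.2 i • dir i q.2)) (𝓝 (t, u₀))
      (𝓝 (t, 0)) := by
    rw [← hu₀i]
    exact (continuous_fst.prodMk (hsm.continuous.comp continuous_snd)).continuousAt
  have hct : ∀ᶠ q : T × Coord 𝕜 n in 𝓝 (t, 0), q.2 ∈ centredTarget 𝕜 n p :=
    continuousAt_snd.eventually
      ((isOpen_centredTarget p).mem_nhds (zero_mem_centredTarget (𝕜 := 𝕜) p))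
  have key : ∀ᶠ q : T × Coord 𝕜 n in 𝓝 (t, u₀),
      h' q.1 ((excChart p i).symm q.2) ∈ (excChart (𝕜 := 𝕜) p j).source ∧
      excChart p j (h' q.1 ((excChart p i).symm q.2)) =
        linearChange i j (A q.1 (q.2 i • dir i q.2), q.2) := by
    filter_upwards [hj', hsm0.eventually hct, hsm0.eventually hsrc, hsm0.eventually hGA]
      with q h1 h2 h3 h4
    -- One formula covers points on and off the exceptional locus: where `u_i = 0`, the factor `A`
    -- is evaluated at `0` and equals the derivative.
    refine (H q.1).excChart_apply i j h2 h3 h4 (fun h5 => ?_) h1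
    rw [h5, zero_smul]
    exact hA0 q.1
  refine .of_charts (blowupChart_mem_atlas (excChart_mem_blowupAtlas p i))
    (blowupChart_mem_atlas (excChart_mem_blowupAtlas p j)) hi hj ?_ ?_
  · exact key.mono fun q hq => hq.1
  · exact hΨ.congr (key.mono fun q hq => hq.2)

/-- The analytic form of Hadamard's lemma. Splitting off the last variable of each homogeneous term
of positive degree gives the shifted power series, which has the same radius; its sum is the
required `A`, so analyticity is preserved. -/
theorem exists_clm_factor_of_analyticAt {E F : Type*} [NormedAddCommGroup E] [NormedSpace 𝕜 E]
    [NormedAddCommGroup F] [NormedSpace 𝕜 F] [CompleteSpace F] {G : E → F}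
    (hG : AnalyticAt 𝕜 G 0) :
    ∃ A : E → E →L[𝕜] F, AnalyticAt 𝕜 A 0 ∧ ∀ᶠ v in 𝓝 0, G v = G 0 + A v v := by
  obtain ⟨P, r, hP⟩ := hG
  have hr : r ≤ P.shift.radius := by
    rw [FormalMultilinearSeries.radius_shift]
    exact hP.r_le
  have hA := (P.shift.hasFPowerSeriesOnBall (hP.r_pos.trans_le hr)).mono hP.r_pos hr
  refine ⟨P.shift.sum, hA.analyticAt, ?_⟩
  have hQ := hA.unshift (z := G 0)
  have hPQ : P.shift.unshift (G 0) = P := by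
    ext1 m
    cases m with
    | zero =>
      ext v
      simpa [FormalMultilinearSeries.unshift] using (hP.coeff_zero v).symm
    | succ m => exact (continuousMultilinearCurryRightEquiv' 𝕜 m E F).symm_apply_apply (P (m + 1))
  rw [hPQ] at hQ
  filter_upwards [Metric.eball_mem_nhds (0 : E) hP.r_pos] with v hv
  simpa using hP.unique hQ hv

/-- If `h` is analytic at `p`, then the induced map of the blowup is analytic at the points of
the exceptional locus. -/
theorem contMDiffAt_omega_blowup_exc [IsManifold 𝓘(𝕜, Coord 𝕜 n) ω M]
    {h : M → M} {h' : Blowup 𝕜 n p → Blowup 𝕜 n p} (H : IsBlowupMap h h') (hp : h p = p)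
    (hd : ContMDiffAt 𝓘(𝕜, Coord 𝕜 n) 𝓘(𝕜, Coord 𝕜 n) ω h p) (L : ℙ 𝕜 (Coord 𝕜 n)) :
    ContMDiffAt 𝓘(𝕜, Coord 𝕜 n) 𝓘(𝕜, Coord 𝕜 n) ω h' (.exc L) := by
  have : IsManifold 𝓘(𝕜, Coord 𝕜 n) ((1 : ℕ) : WithTop ℕ∞) M := .of_le (n := ω) le_top
  have : IsManifold 𝓘(𝕜, Coord 𝕜 n) ((0 : ℕ) : WithTop ℕ∞) M := .of_le (n := ω) le_top
  have hd1 : ContMDiffAt 𝓘(𝕜, Coord 𝕜 n) 𝓘(𝕜, Coord 𝕜 n) ((1 : ℕ) : WithTop ℕ∞) h p :=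
    hd.of_le le_top
  have hF : ContMDiffFamilyAt 𝕜 n 1 (fun _ : Unit => h) () p := .const hd1 ()
  have hd' : MDifferentiableAt 𝓘(𝕜, Coord 𝕜 n) 𝓘(𝕜, Coord 𝕜 n) h p :=
    hd.mdifferentiableAt (by simp)
  -- The chart criterion for regularity at a point also asks for continuity; this is the case `r =
  -- 0` of the family statement.
  have hcont : ContinuousAt h' (.exc L) :=
    ((ContMDiffFamilyAt.blowup_exc (T := Unit) (h := fun _ => h) (h' := fun _ => h') (r := 0)
      (fun _ => H) (fun _ => hp) (fun _ => hd') L hF).contMDiffAt).continuousAt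
  have hsrc' := (hF.centred (fun _ => hp)).1
  have hsrc : ∀ᶠ v : Coord 𝕜 n in 𝓝 0, h (uncentred 𝕜 n p v) ∈ (chartAt (Coord 𝕜 n) p).source :=
    (Continuous.prodMk_right ()).continuousAt.eventually hsrc'
  have hGω : ContDiffAt 𝕜 ω (fun v => centred 𝕜 n p (h (uncentred 𝕜 n p v))) 0 := by
    set φ := chartAt (Coord 𝕜 n) p
    have h1 := ((contMDiffAt_iff_of_mem_maximalAtlas
      (IsManifold.chart_mem_maximalAtlas p) (IsManifold.chart_mem_maximalAtlas p)
      (mem_chart_source _ p) (by rw [hp]; exact mem_chart_source _ p)).1 hd).2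
    have h2 : ContDiffAt 𝕜 ω (φ ∘ h ∘ φ.symm) (φ p) := by
      simpa [ModelWithCorners.range_eq_univ, contDiffWithinAt_univ] using h1
    have h3 : ContDiffAt 𝕜 ω (fun v => φ (h (φ.symm (φ p + v)))) 0 :=
      ContDiffAt.comp (0 : Coord 𝕜 n) (g := φ ∘ h ∘ φ.symm) (f := fun v => φ p + v)
        (by rwa [add_zero]) (contDiffAt_const.add contDiffAt_id)
    exact h3.sub contDiffAt_const
  obtain ⟨A, hA, hGA⟩ := exists_clm_factor_of_analyticAt hGω.analyticAt
  simp only [uncentred_zero, hp, show centred 𝕜 n p p = 0 by simp [centred], zero_add] at hGA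
  -- Differentiate `A v v` at `0` by the product rule; the term containing the derivative of `A` is
  -- applied to the vector `0` and vanishes.
  have hA0 : A 0 = derivAt 𝕜 n h p := by
    rw [derivAt_eq_fderiv hp hd']
    have h1 := hA.differentiableAt.hasFDerivAt.clm_apply (hasFDerivAt_id (0 : Coord 𝕜 n))
    have h2 := h1.congr_of_eventuallyEq (f₁ := fun v => centred 𝕜 n p (h (uncentred 𝕜 n p v))) hGA
    rw [h2.fderiv]
    ext v
    simp
  obtain ⟨i, j, hi, hj, hij⟩ := H.exists_chart L
  set u₀ : Coord 𝕜 n := excChart p i (.exc L : Blowup 𝕜 n p) with hu₀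
  have hu₀i : u₀ i • dir i u₀ = 0 := by rw [hu₀, excChart_exc_apply_self, zero_smul]
  have hsm : ContDiff 𝕜 ω (fun u : Coord 𝕜 n => u i • dir i u) := contDiff_smul_dir _ i
  have hB : ContDiffAt 𝕜 ω (fun u => (A (u i • dir i u), u)) u₀ :=
    (ContDiffAt.comp u₀ (g := A) (by rw [hu₀i]; exact hA.contDiffAt)
      hsm.contDiffAt).prodMk contDiffAt_id
  have hB0 : A (u₀ i • dir i u₀) (dir i u₀) j ≠ 0 := by
    rw [hu₀i, hA0]
    exact hij
  have hΨ := ContDiffAt.comp u₀ (f := fun u => (A (u i • dir i u), u))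
    (contDiffAt_linearChange ω i j hB0) hB
  have hj' : ∀ᶠ u in 𝓝 u₀, A (u i • dir i u) (dir i u) j ≠ 0 := by
    have h2 : Continuous (fun q : (Coord 𝕜 n →L[𝕜] Coord 𝕜 n) × Coord 𝕜 n =>
        q.1 (dir i q.2) j) := by
      have := (contDiff_dir (𝕜 := 𝕜) 0 i).continuous
      fun_prop
    exact (h2.continuousAt.comp hB.continuousAt).eventually_ne hB0
  have hsm0 : Tendsto (fun u : Coord 𝕜 n => u i • dir i u) (𝓝 u₀) (𝓝 0) := by
    rw [← hu₀i]
    exact hsm.continuous.continuousAt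
  have hct : ∀ᶠ v : Coord 𝕜 n in 𝓝 0, v ∈ centredTarget 𝕜 n p :=
    (isOpen_centredTarget p).mem_nhds (zero_mem_centredTarget (𝕜 := 𝕜) p)
  rw [contMDiffAt_iff_of_mem_maximalAtlas
    (IsManifold.subset_maximalAtlas (blowupChart_mem_atlas (excChart_mem_blowupAtlas p i)))
    (IsManifold.subset_maximalAtlas (blowupChart_mem_atlas (excChart_mem_blowupAtlas p j))) hi hj]
  refine ⟨hcont, ?_⟩
  rw [ModelWithCorners.range_eq_univ, contDiffWithinAt_univ]
  refine hΨ.congr_of_eventuallyEq ?_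
  filter_upwards [hj', hsm0.eventually hct, hsm0.eventually hsrc, hsm0.eventually hGA]
    with u h1 h2 h3 h4
  refine (H.excChart_apply i j h2 h3 h4 (fun h5 => ?_) h1).2
  rw [h5, zero_smul, hA0]

end BlowupFamilies

/-! ### Function space topologies and jointly continuous families -/

section Topologies

open Filter

variable {𝕜 : Type} [RCLike 𝕜] {n : ℕ} {X : Type*} [TopologicalSpace X]
  [ChartedSpace (Coord 𝕜 n) X] {T : Type*} [TopologicalSpace T] {k : WithTop ℕ∞} {A : Set X}

theorem ContMDiffFamilyAt.const_aut {r : ℕ} [IsManifold 𝓘(𝕜, Coord 𝕜 n) r X] (hr : r ≤ k)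
    (f : Aut 𝕜 n k X A) (t : T) (x : X) : ContMDiffFamilyAt 𝕜 n r (fun _ => f.1) t x :=
  .const ((f.2.1 x).of_le hr) t

/-- The image under the inverse chart of a small closed ball is a compact set to test on. Parameters
near `t` give derivatives uniformly close on the ball to those of `β t`, which are themselves
continuous at the base point. -/
theorem contMDiffFamilyAt_of_continuous_weakTopology {r : ℕ} [IsManifold 𝓘(𝕜, Coord 𝕜 n) r X]
    {β : T → Aut 𝕜 n k X A} (hβ : Continuous[_, weakTopology 𝕜 n k X A] β) (hr : r ≤ k)
    (t : T) (x : X) : ContMDiffFamilyAt 𝕜 n r (fun s => (β s).1) t x := by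
  intro e he e' he' hx hx'
  have hx₀ : e.symm (e x) = x := e.left_inv hx
  obtain ⟨hev, hf⟩ := ContMDiffFamilyAt.const_aut (r := r) hr (β t) () x e he e' he' hx hx'
  have hev' : ∀ᶠ w in 𝓝 (e x), w ∈ e.target ∧ (β t).1 (e.symm w) ∈ e'.source :=
    Filter.Eventually.and (e.open_target.mem_nhds (e.map_source hx))
      ((Continuous.prodMk_right ()).continuousAt.eventually hev)
  obtain ⟨ρ, hρ, hb⟩ := Metric.nhds_basis_closedBall.eventually_iff.1 hev'
  set K : Set X := e.symm '' Metric.closedBall (e x) ρ with hK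
  have hKc : IsCompact K := (isCompact_closedBall (e x) ρ).image_of_continuousOn
    (e.continuousOn_symm.mono fun w hw => (hb hw).1)
  have hKe : K ⊆ e.source := by
    rintro _ ⟨w, hw, rfl⟩
    exact e.map_target (hb hw).1
  have hKe' : MapsTo (β t).1 K e'.source := by
    rintro _ ⟨w, hw, rfl⟩
    exact (hb hw).2
  have key : ∀ ε > 0, ∀ᶠ s in 𝓝 t, ∀ w ∈ Metric.closedBall (e x) ρ,
      (β s).1 (e.symm w) ∈ e'.source ∧ ∀ j ≤ r,
        ‖iteratedFDeriv 𝕜 j (e' ∘ (β s).1 ∘ e.symm) w -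
          iteratedFDeriv 𝕜 j (e' ∘ (β t).1 ∘ e.symm) w‖ < ε := by
    intro ε hε
    have hopen := continuous_def.1 hβ _ (TopologicalSpace.isOpen_generateFrom_of_mem
      ⟨β t, e, e', K, r, ε, he, he', hKc, hKe, hKe', hr, hε, rfl⟩)
    filter_upwards [hopen.mem_nhds (x := t) ⟨hKe', fun y _ j _ => by simpa using hε⟩]
      with s hs w hw
    refine ⟨hs.1 ⟨w, hw, rfl⟩, fun j hj => ?_⟩
    have h1 := hs.2 _ ⟨w, hw, rfl⟩ j hj
    rwa [e.right_inv (hb hw).1] at h1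
  have hball : Metric.closedBall (e x) ρ ∈ 𝓝 (e x) := Metric.closedBall_mem_nhds _ hρ
  refine ⟨?_, ?_, fun j hj => ?_⟩
  · filter_upwards [(key 1 one_pos).prod_nhds hball] with q hq
    exact (hq.1 q.2 hq.2).1
  · filter_upwards [(key 1 one_pos).prod_nhds hball] with q hq
    have h1 := (hb hq.2).1
    have h2 := (ContMDiffFamilyAt.const_aut (r := r) hr (β q.1) () (e.symm q.2) e he e' he'
      (e.map_target h1) (hq.1 q.2 hq.2).1).2.contDiffAt
    rwa [e.right_inv h1] at h2
  · have h1 : ContinuousAt (iteratedFDeriv 𝕜 j (e' ∘ (β t).1 ∘ e.symm)) (e x) :=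
      (hf.contDiffAt.iteratedFDeriv_right (m := 0) (i := j) (by simpa using hj)).continuousAt
    refine Metric.tendsto_nhds.2 fun ε hε => ?_
    filter_upwards [(key (ε / 2) (half_pos hε)).prod_nhds
      (Filter.inter_mem hball (Metric.tendsto_nhds.1 h1 (ε / 2) (half_pos hε)))] with q hq
    have h2 := (hq.1 q.2 hq.2.1).2 j hj
    rw [← dist_eq_norm] at h2
    exact (dist_triangle _ _ _).trans_lt ((add_lt_add h2 hq.2.2).trans_eq (add_halves ε))

/-- Joint continuity keeps each strict inequality true near every point of `K`, and compactness of
`K` makes the neighbourhood of the parameter uniform. -/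
theorem continuous_weakTopology_of_contMDiffFamilyAt [IsManifold 𝓘(𝕜, Coord 𝕜 n) k X]
    {β : T → Aut 𝕜 n k X A}
    (H : ∀ (r : ℕ), r ≤ k → ∀ t x, ContMDiffFamilyAt 𝕜 n r (fun s => (β s).1) t x) :
    Continuous[_, weakTopology 𝕜 n k X A] β := by
  refine continuous_generateFrom_iff.2 ?_
  rintro _ ⟨f, e, e', K, r, ε, he, he', hK, hKe, hKe', hr, hε, rfl⟩
  have : IsManifold 𝓘(𝕜, Coord 𝕜 n) r X := .of_le hr
  rw [isOpen_iff_mem_nhds]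
  rintro t ⟨ht, ht'⟩
  have key : ∀ x ∈ K, ∀ᶠ q : T × X in 𝓝 (t, x), q.2 ∈ K → (β q.1).1 q.2 ∈ e'.source ∧
      ∀ j ≤ r, ‖iteratedFDeriv 𝕜 j (e' ∘ (β q.1).1 ∘ e.symm) (e q.2) -
          iteratedFDeriv 𝕜 j (e' ∘ f.1 ∘ e.symm) (e q.2)‖ < ε := by
    intro x hx
    obtain ⟨hev, hF⟩ := H r hr t x e he e' he' (hKe hx) (ht hx)
    obtain ⟨-, hf⟩ := ContMDiffFamilyAt.const_aut (r := r) hr f t x e he e' he' (hKe hx)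
      (hKe' hx)
    have hg : ContinuousAt (fun q : T × X => (q.1, e q.2)) (t, x) :=
      continuousAt_fst.prodMk ((e.continuousAt (hKe hx)).comp_of_eq continuousAt_snd rfl)
    have h1 : ∀ j ≤ r, ∀ᶠ q : T × Coord 𝕜 n in 𝓝 (t, e x),
        ‖iteratedFDeriv 𝕜 j (e' ∘ (β q.1).1 ∘ e.symm) q.2 -
          iteratedFDeriv 𝕜 j (e' ∘ f.1 ∘ e.symm) q.2‖ < ε := fun j hj =>
      (((hF.2 j hj).sub (hf.2 j hj)).norm).eventually_lt continuousAt_const (ht' x hx j hj)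
    have h2 : ∀ᶠ q : T × Coord 𝕜 n in 𝓝 (t, e x), ∀ j ∈ Finset.range (r + 1),
        ‖iteratedFDeriv 𝕜 j (e' ∘ (β q.1).1 ∘ e.symm) q.2 -
          iteratedFDeriv 𝕜 j (e' ∘ f.1 ∘ e.symm) q.2‖ < ε :=
      (Filter.eventually_all_finset _).2 fun j hj => h1 j (by simpa [Nat.lt_succ_iff] using hj)
    filter_upwards [hg.eventually hev, hg.eventually h2] with q h3 h4 hq
    refine ⟨?_, fun j hj => h4 j (by simpa [Nat.lt_succ_iff] using hj)⟩
    rwa [e.left_inv (hKe hq)] at h3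
  filter_upwards [hK.eventually_forall_of_forall_eventually (P := fun s x => x ∈ K →
    (β s).1 x ∈ e'.source ∧ ∀ j ≤ r, ‖iteratedFDeriv 𝕜 j (e' ∘ (β s).1 ∘ e.symm) (e x) -
      iteratedFDeriv 𝕜 j (e' ∘ f.1 ∘ e.symm) (e x)‖ < ε) key]
    with s hs
  exact ⟨fun x hx => (hs x hx hx).1, fun x hx => (hs x hx hx).2⟩

/-- The exponential law for locally compact spaces. -/
theorem continuous_compactOpenTopology_iff [LocallyCompactSpace X] {β : T → Aut 𝕜 n k X A} :
    Continuous[_, compactOpenTopology 𝕜 n k X A] β ↔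
      Continuous fun q : T × X => (β q.1).1 q.2 := by
  rw [continuous_induced_rng]
  constructor
  · intro h
    exact ContinuousMap.continuous_uncurry_of_continuous ⟨_, h⟩
  · intro h
    exact ContinuousMap.continuous_of_continuous_uncurry _ h

end Topologies

/-! ### The group homomorphism -/

section BlowupHom

variable {𝕜 : Type} [RCLike 𝕜] {n : ℕ} {M : Type*} [TopologicalSpace M]
  [ChartedSpace (Coord 𝕜 n) M] {k k' : WithTop ℕ∞} {p : M}

theorem aut_apply_base (h : Aut 𝕜 n k M {p}) : h.1 p = p := by
  have := h.2.2.2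
  rwa [image_singleton, singleton_eq_singleton_iff] at this

theorem aut_mdifferentiable (hk : 1 ≤ k) (h : Aut 𝕜 n k M {p}) :
    MDifferentiable 𝓘(𝕜, Coord 𝕜 n) 𝓘(𝕜, Coord 𝕜 n) h.1 :=
  h.2.1.mdifferentiable (by rintro rfl; simp at hk)

variable [T1Space M]

/-- By the chain rule the derivative of the inverse is a left inverse of the derivative at `p`,
which is therefore injective. -/
theorem aut_isBlowupMap (hk : 1 ≤ k) (h : Aut 𝕜 n k M {p}) :
    IsBlowupMap h.1 (blowupMap 𝕜 n p h.1) := by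
  refine isBlowupMap_blowupMap (fun x hx hp => hx
    (h.1.injective (hp.trans (aut_apply_base h).symm))) ?_
  have h1 := derivAt_comp (aut_apply_base h)
    (aut_mdifferentiable hk (h⁻¹) p) (aut_mdifferentiable hk h p)
  have h2 : (h⁻¹).1 ∘ h.1 = id := funext h.1.symm_apply_apply
  rw [h2, derivAt_id] at h1
  exact Function.LeftInverse.injective (g := derivAt 𝕜 n (h⁻¹).1 p) fun v =>
    (DFunLike.congr_fun h1 v).symm

theorem aut_blowupMap_mul (hk : 1 ≤ k) (g h : Aut 𝕜 n k M {p}) :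
    blowupMap 𝕜 n p (g * h).1 = blowupMap 𝕜 n p g.1 ∘ blowupMap 𝕜 n p h.1 :=
  (aut_isBlowupMap hk (g * h)).unique (IsBlowupMap.comp (g := g.1) (h := h.1) (aut_apply_base h)
    (aut_mdifferentiable hk g p) (aut_mdifferentiable hk h p) (aut_isBlowupMap hk g) (aut_isBlowupMap hk h))

theorem aut_blowupMap_one (hk : 1 ≤ k) :
    blowupMap 𝕜 n p (1 : Aut 𝕜 n k M {p}).1 = id :=
  (aut_isBlowupMap hk 1).unique IsBlowupMap.id

/-- The algebraic half of the theorem, given regularity of the lifts. The target order `k'` is left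
free so as to serve both the real case, with loss of a derivative, and the holomorphic case,
without. -/
theorem exists_blowupHom (hk : 1 ≤ k)
    (hs : ∀ h : Aut 𝕜 n k M {p},
      ContMDiff 𝓘(𝕜, Coord 𝕜 n) 𝓘(𝕜, Coord 𝕜 n) k' (blowupMap 𝕜 n p h.1)) :
    ∃ β : Aut 𝕜 n k M {p} →* Aut 𝕜 n k' (Blowup 𝕜 n p) (exceptionalLocus 𝕜 n p),
      (∀ h, IsBlowupMap h.1 (β h).1) ∧ Function.Injective β := by
  have hinv : ∀ (h : Aut 𝕜 n k M {p}) z,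
      blowupMap 𝕜 n p (h⁻¹).1 (blowupMap 𝕜 n p h.1 z) = z := fun h z => by
    have := aut_blowupMap_mul hk h⁻¹ h
    rw [inv_mul_cancel, aut_blowupMap_one hk] at this
    exact (congrFun this z).symm
  have hinv' : ∀ (h : Aut 𝕜 n k M {p}) z,
      blowupMap 𝕜 n p h.1 (blowupMap 𝕜 n p (h⁻¹).1 z) = z := fun h z => by
    simpa using hinv h⁻¹ z
  let e : Aut 𝕜 n k M {p} → (Blowup 𝕜 n p ≃ₜ Blowup 𝕜 n p) := fun h =>
    { toFun := blowupMap 𝕜 n p h.1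
      invFun := blowupMap 𝕜 n p (h⁻¹).1
      left_inv := hinv h
      right_inv := hinv' h
      continuous_toFun := (hs h).continuous
      continuous_invFun := (hs h⁻¹).continuous }
  have hmaps : ∀ (h : Aut 𝕜 n k M {p}), ∀ z ∈ exceptionalLocus 𝕜 n p,
      blowupMap 𝕜 n p h.1 z ∈ exceptionalLocus 𝕜 n p := fun h z hz => by
    change blowdown (blowupMap 𝕜 n p h.1 z) = p
    rw [(aut_isBlowupMap hk h).blowdown_apply (aut_apply_base h), show blowdown z = p from hz,
      aut_apply_base h]
  have he : ∀ h, e h ∈ Aut 𝕜 n k' (Blowup 𝕜 n p) (exceptionalLocus 𝕜 n p) := fun h =>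
    ⟨hs h, hs h⁻¹, Subset.antisymm (by rintro _ ⟨z, hz, rfl⟩; exact hmaps h z hz)
      fun z hz => ⟨_, hmaps h⁻¹ z hz, hinv' h z⟩⟩
  let β : Aut 𝕜 n k M {p} →* Aut 𝕜 n k' (Blowup 𝕜 n p) (exceptionalLocus 𝕜 n p) :=
    MonoidHom.mk' (fun h => ⟨e h, he h⟩) fun g h =>
      Subtype.ext (Homeomorph.ext fun z => congrFun (aut_blowupMap_mul hk g h) z)
  refine ⟨β, fun h => aut_isBlowupMap hk h, fun g h hgh =>
    Subtype.ext (Homeomorph.ext fun x => ?_)⟩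
  -- Both maps fix `p`; at any other point the value of the map is the blowdown of the value of its
  -- lift.
  by_cases hx : x = p
  · rw [hx, aut_apply_base g, aut_apply_base h]
  · have h1 : blowupMap 𝕜 n p g.1 = blowupMap 𝕜 n p h.1 :=
      congrArg (fun f => (f.1 : Blowup 𝕜 n p → Blowup 𝕜 n p)) hgh
    have h2 := (aut_isBlowupMap hk g).blowdown_apply (aut_apply_base g) (.off x hx)
    rw [h1, (aut_isBlowupMap hk h).blowdown_apply (aut_apply_base h)] at h2
    exact h2.symm

/-- A `C^(r+1)` family of automorphisms fixing `p` induces a `C^r` family of maps of the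
blowup. -/
theorem ContMDiffFamilyAt.blowup {T : Type*} [TopologicalSpace T] {r : ℕ}
    [IsManifold 𝓘(𝕜, Coord 𝕜 n) r M] (hk : 1 ≤ k) {f : T → Aut 𝕜 n k M {p}}
    {f' : T → Blowup 𝕜 n p → Blowup 𝕜 n p} (H : ∀ s, IsBlowupMap (f s).1 (f' s)) {t : T}
    (F : ∀ x, ContMDiffFamilyAt 𝕜 n (r + 1) (fun s => (f s).1) t x) (z : Blowup 𝕜 n p) :
    ContMDiffFamilyAt 𝕜 n r f' t z := by
  cases z with
  | off x hx => exact ((F x).of_le (Nat.le_succ r)).blowup_off H (fun s => aut_apply_base (f s)) hx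
  | exc L =>
    exact (F p).blowup_exc H (fun s => aut_apply_base (f s))
      (fun s => aut_mdifferentiable hk (f s) p) L

end BlowupHom

/-! ### The real case -/

section Real

/-- Order `r` upstairs uses order `r + 1` downstairs; as `k ≥ 1`, the truncated subtraction can be
undone, also for `k = ∞`. -/
theorem natCast_add_one_le {k : ℕ∞} (hk : 1 ≤ k) {r : ℕ}
    (hr : (r : WithTop ℕ∞) ≤ ((k - 1 : ℕ∞) : WithTop ℕ∞)) : ((r + 1 : ℕ) : WithTop ℕ∞) ≤ k := by
  have h1 : (r : ℕ∞) ≤ k - 1 := by exact_mod_cast hr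
  have h2 : (r : ℕ∞) + 1 ≤ k := (add_le_add_left h1 1).trans_eq (tsub_add_cancel_of_le hk)
  exact_mod_cast h2

theorem exists_blowupHom_weakTopology {n : ℕ} {M : Type*} [TopologicalSpace M] [T1Space M]
    [ChartedSpace (Coord ℝ n) M] [IsManifold 𝓘(ℝ, Coord ℝ n) ∞ M] (p : M) {k : ℕ∞}
    (hk : 1 ≤ k) :
    ∃ β : Aut ℝ n k M {p} →*
        Aut ℝ n ((k - 1 : ℕ∞) : WithTop ℕ∞) (Blowup ℝ n p) (exceptionalLocus ℝ n p),
      (∀ h, IsBlowupMap h.1 (β h).1) ∧ Function.Injective β ∧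
      Continuous[weakTopology ℝ n k M {p}, weakTopology ℝ n ((k - 1 : ℕ∞) : WithTop ℕ∞)
        (Blowup ℝ n p) (exceptionalLocus ℝ n p)] β ∧
      ∀ h, ∀ z ∉ exceptionalLocus ℝ n p,
        ContMDiffAt 𝓘(ℝ, Coord ℝ n) 𝓘(ℝ, Coord ℝ n) k (β h).1 z := by
  have hM : ∀ r : ℕ, IsManifold 𝓘(ℝ, Coord ℝ n) (r : WithTop ℕ∞) M := fun r =>
    .of_le (n := ∞) (by exact_mod_cast le_top)
  have hk' : (1 : WithTop ℕ∞) ≤ k := by exact_mod_cast hk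
  have hs : ∀ h : Aut ℝ n k M {p}, ContMDiff 𝓘(ℝ, Coord ℝ n) 𝓘(ℝ, Coord ℝ n)
      ((k - 1 : ℕ∞) : WithTop ℕ∞) (blowupMap ℝ n p h.1) := by
    intro h z
    -- Testing all finite orders treats `k = ∞` on the same footing as finite `k`.
    refine contMDiffAt_iff_nat.2 fun r hr => ?_
    have hr' := natCast_add_one_le hk (r := r) (by exact_mod_cast hr)
    exact (ContMDiffFamilyAt.blowup (T := Unit) (f := fun _ => h) (r := r) hk'
      (fun _ => aut_isBlowupMap hk' h) (t := ()) (fun x => .const_aut hr' h () x) z).contMDiffAt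
  obtain ⟨β, hβ, hinj⟩ := exists_blowupHom hk' hs
  refine ⟨β, hβ, hinj, ?_, fun h z hz => ?_⟩
  · let _ : TopologicalSpace (Aut ℝ n k M {p}) := weakTopology ℝ n k M {p}
    have : IsManifold 𝓘(ℝ, Coord ℝ n) ((k - 1 : ℕ∞) : WithTop ℕ∞) M :=
      .of_le (n := ∞) (by exact_mod_cast le_top)
    refine continuous_weakTopology_of_contMDiffFamilyAt fun r hr h z => ?_
    -- The group itself, with its weak topology, is the parameter space, and the identity is the
    -- family.
    exact ContMDiffFamilyAt.blowup hk' (f := fun h => h) hβ (fun x =>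
      contMDiffFamilyAt_of_continuous_weakTopology continuous_id (natCast_add_one_le hk hr) h x) z
  · cases z with
    | off x hx =>
      have : IsManifold 𝓘(ℝ, Coord ℝ n) k M := .of_le (n := ∞) (by exact_mod_cast le_top)
      exact contMDiffAt_blowup_off (hβ h) (aut_apply_base h) hx (h.2.1 x)
    | exc L => exact absurd rfl hz

end Real

/-! ### The holomorphic case -/

section Complex

open Filter

/-- Cauchy's estimate: a jointly continuous family of holomorphic maps is a `C^1` family. -/
theorem ContDiffFamilyAt.of_continuousAt {T : Type*} [TopologicalSpace T] {E F : Type*}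
    [NormedAddCommGroup E] [NormedSpace ℂ E] [ProperSpace E] [NormedAddCommGroup F]
    [NormedSpace ℂ F] {f : T → E → F} {t : T} {x : E}
    (h : ∀ᶠ q : T × E in 𝓝 (t, x),
      ContDiffAt ℂ 1 (f q.1) q.2 ∧ ContinuousAt (fun q : T × E => f q.1 q.2) q) :
    ContDiffFamilyAt ℂ 1 f t x := by
  have hdiff : ∀ᶠ q : T × E in 𝓝 (t, x), DifferentiableAt ℂ (f q.1) q.2 :=
    h.mono fun q hq => hq.1.differentiableAt (by simp)
  refine ContDiffFamilyAt.succ (r := 0) h.self_of_nhds.2 hdiff ⟨?_, fun j hj => ?_⟩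
  · filter_upwards [h] with q hq
    exact hq.1.fderiv_right (m := 0) (by simp)
  obtain rfl : j = 0 := by omega
  simp only [iteratedFDeriv_zero_eq_comp, Function.comp_apply]
  refine (continuousMultilinearCurryFin0 ℂ E (E →L[ℂ] F)).symm.continuous.continuousAt.comp
    (f := fun q : T × E => _root_.fderiv ℂ (f q.1) q.2) ?_
  obtain ⟨δ, hδ, hb⟩ := exists_ball_of_eventually h
  have hR : 0 < δ / 2 := half_pos hδ
  have hsub : Metric.closedBall x (δ / 2) ⊆ Metric.ball x δ :=
    Metric.closedBall_subset_ball (half_lt_self hδ)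
  have hunif : ∀ η > 0, ∀ᶠ s in 𝓝 t, ∀ y ∈ Metric.closedBall x (δ / 2),
      ‖f s y - f t y‖ < η := by
    intro η hη
    refine (isCompact_closedBall x (δ / 2)).eventually_forall_of_forall_eventually
      (P := fun s y => ‖f s y - f t y‖ < η) fun y hy => ?_
    have h1 := (hb.self_of_nhds y (hsub hy)).2
    have h2 : ContinuousAt (fun q : T × E => f t q.2) (t, y) :=
      (hb.self_of_nhds y (hsub hy)).1.continuousAt.comp_of_eq continuousAt_snd rfl
    exact (h1.sub h2).norm.eventually_lt continuousAt_const (by simpa using hη)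
  have hD : ContinuousAt (_root_.fderiv ℂ (f t)) x :=
    (h.self_of_nhds.1.fderiv_right (m := 0) (by simp)).continuousAt
  refine Metric.tendsto_nhds.2 fun ε hε => ?_
  -- Let `η` be this number. If `f s` and `f t` differ by less than `η` on a ball of radius `δ / 4`,
  -- their difference maps it into a ball of radius `2 η` around the central value, and Cauchy's
  -- estimate bounds the difference of derivatives by `2 η / (δ / 4) = ε / 4`. The variation of the
  -- derivative of `f t` takes another `ε / 2`.
  have hη : 0 < ε / 2 * (δ / 4) / 4 := by positivity
  filter_upwards [((hunif _ hη).and hb).prod_nhds (Filter.inter_mem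
    (Metric.ball_mem_nhds x (show 0 < δ / 4 by positivity))
    (Metric.tendsto_nhds.1 hD (ε / 2) (half_pos hε)))] with q hq
  obtain ⟨⟨hq1, hq2⟩, hq3, hq4⟩ := hq
  have hball : Metric.ball q.2 (δ / 4) ⊆ Metric.closedBall x (δ / 2) := fun y hy => by
    rw [Metric.mem_ball] at hy hq3
    rw [Metric.mem_closedBall]
    linarith [dist_triangle y q.2 x]
  have hd : ∀ s, (∀ y ∈ Metric.ball x δ, ContDiffAt ℂ 1 (f s) y ∧
      ContinuousAt (fun q : T × E => f q.1 q.2) (s, y)) →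
      ∀ y ∈ Metric.ball q.2 (δ / 4), DifferentiableAt ℂ (f s) y := fun s hs y hy =>
    (hs y (hsub (hball hy))).1.differentiableAt (by simp)
  have hq5 : q.2 ∈ Metric.ball q.2 (δ / 4) := Metric.mem_ball_self (by positivity)
  have hd1 := hd q.1 hq2
  have hd2 := hd t hb.self_of_nhds
  have hC := Complex.norm_fderiv_le_div_of_mapsTo_ball (f := fun y => f q.1 y - f t y)
    (c := q.2) (R₁ := δ / 4) (R₂ := 2 * (ε / 2 * (δ / 4) / 4))
    (fun y hy => ((hd1 y hy).sub (hd2 y hy)).differentiableWithinAt) (fun y hy => by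
      rw [Metric.mem_closedBall, dist_eq_norm]
      refine (norm_sub_le _ _).trans ?_
      linarith [(hq1 y (hball hy)).le, (hq1 q.2 (hball hq5)).le]) (by positivity)
  rw [fderiv_fun_sub (hd1 _ hq5) (hd2 _ hq5), ← dist_eq_norm] at hC
  have hC' : 2 * (ε / 2 * (δ / 4) / 4) / (δ / 4) = ε / 4 := by field_simp
  rw [hC'] at hC
  have hq4' : dist (_root_.fderiv ℂ (f t) q.2) (_root_.fderiv ℂ (f t) x) < ε / 2 := hq4
  linarith [dist_triangle (_root_.fderiv ℂ (f q.1) q.2) (_root_.fderiv ℂ (f t) q.2)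
    (_root_.fderiv ℂ (f t) x)]

/-- Joint continuity passes to the local expressions, and each of them is holomorphic, so Cauchy's
estimate applies in charts. -/
theorem ContMDiffFamilyAt.of_continuous {n : ℕ} {X : Type*} [TopologicalSpace X]
    [ChartedSpace (Coord ℂ n) X] [IsManifold 𝓘(ℂ, Coord ℂ n) ω X] {A : Set X}
    {T : Type*} [TopologicalSpace T] {f : T → Aut ℂ n ω X A}
    (hf : Continuous fun q : T × X => (f q.1).1 q.2) (t : T) (x : X) :
    ContMDiffFamilyAt ℂ n 1 (fun s => (f s).1) t x := by
  have : IsManifold 𝓘(ℂ, Coord ℂ n) ((1 : ℕ) : WithTop ℕ∞) X := .of_le (n := ω) le_top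
  intro e he e' he' hx hx'
  have hc : ∀ w ∈ e.target, ∀ s,
      ContinuousAt (fun q : T × Coord ℂ n => (f q.1).1 (e.symm q.2)) (s, w) := fun w hw s =>
    hf.continuousAt.comp (f := fun q : T × Coord ℂ n => (q.1, e.symm q.2)) (x := (s, w))
      (continuousAt_fst.prodMk ((e.continuousAt_symm hw).comp_of_eq continuousAt_snd rfl))
  have hev : ∀ᶠ q : T × Coord ℂ n in 𝓝 (t, e x), (f q.1).1 (e.symm q.2) ∈ e'.source :=
    (hc _ (e.map_source hx) t).eventually
      (e'.open_source.mem_nhds (by simpa only [e.left_inv hx] using hx'))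
  have htgt : ∀ᶠ q : T × Coord ℂ n in 𝓝 (t, e x), q.2 ∈ e.target :=
    continuousAt_snd.eventually (e.open_target.mem_nhds (e.map_source hx))
  refine ⟨hev, .of_continuousAt ?_⟩
  filter_upwards [hev, htgt] with q h1 h2
  refine ⟨?_, ContinuousAt.comp (g := e')
    (f := fun q : T × Coord ℂ n => (f q.1).1 (e.symm q.2)) (e'.continuousAt h1) (hc q.2 h2 q.1)⟩
  have h3 := (ContMDiffFamilyAt.const_aut (r := 1) le_top (f q.1) () (e.symm q.2) e he e' he'
    (e.map_target h2) h1).2.contDiffAt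
  rw [e.right_inv h2] at h3
  exact_mod_cast h3

theorem exists_blowupHom_compactOpenTopology {n : ℕ} {M : Type*} [TopologicalSpace M] [T1Space M]
    [ChartedSpace (Coord ℂ n) M] [IsManifold 𝓘(ℂ, Coord ℂ n) ω M] (p : M) :
    ∃ β : Aut ℂ n ω M {p} →* Aut ℂ n ω (Blowup ℂ n p) (exceptionalLocus ℂ n p),
      (∀ h, IsBlowupMap h.1 (β h).1) ∧ Function.Injective β ∧
      Continuous[compactOpenTopology ℂ n ω M {p},
        compactOpenTopology ℂ n ω (Blowup ℂ n p) (exceptionalLocus ℂ n p)] β := by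
  have hk : (1 : WithTop ℕ∞) ≤ ω := le_top
  have hM : ∀ r : ℕ, IsManifold 𝓘(ℂ, Coord ℂ n) (r : WithTop ℕ∞) M := fun r =>
    .of_le (n := ω) le_top
  have : LocallyCompactSpace M := ChartedSpace.locallyCompactSpace (Coord ℂ n) M
  have : LocallyCompactSpace (Blowup ℂ n p) := ChartedSpace.locallyCompactSpace (Coord ℂ n) _
  have hs : ∀ h : Aut ℂ n ω M {p}, ContMDiff 𝓘(ℂ, Coord ℂ n) 𝓘(ℂ, Coord ℂ n) ω
      (blowupMap ℂ n p h.1) := by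
    intro h z
    cases z with
    | off x hx =>
      exact contMDiffAt_blowup_off (aut_isBlowupMap hk h) (aut_apply_base h) hx (h.2.1 x)
    | exc L =>
      exact contMDiffAt_omega_blowup_exc (aut_isBlowupMap hk h) (aut_apply_base h) (h.2.1 p) L
  obtain ⟨β, hβ, hinj⟩ := exists_blowupHom hk hs
  refine ⟨β, hβ, hinj, ?_⟩
  let _ : TopologicalSpace (Aut ℂ n ω M {p}) := compactOpenTopology ℂ n ω M {p}
  refine continuous_compactOpenTopology_iff.2 (continuous_iff_continuousAt.2 fun ⟨h, z⟩ => ?_)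
  exact (ContMDiffFamilyAt.blowup hk (f := fun h => h) hβ (r := 0) (fun x =>
    .of_continuous (continuous_compactOpenTopology_iff.1 continuous_id) h x) z).continuousAt

end Complex

/-! ### Loss of a derivative: examples in the plane -/

section Examples

open Filter

/-- The difference quotient of `x g(x)` at `0` is `g` itself, so continuity of `g` there suffices.
-/
theorem hasDerivAt_zero_id_mul {g : ℝ → ℝ} (hg : ContinuousAt g 0) :
    HasDerivAt (fun x => x * g x) (g 0) 0 := by
  rw [hasDerivAt_iff_tendsto_slope]
  refine (hg.tendsto.mono_left nhdsWithin_le_nhds).congr' ?_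
  filter_upwards [self_mem_nhdsWithin] with x hx
  have hx' : x ≠ 0 := hx
  simp [slope_def_field, hx']

theorem hasDerivAt_pow_succ_mul_abs (k : ℕ) (x : ℝ) :
    HasDerivAt (fun x : ℝ => x ^ (k + 1) * |x|) ((k + 2) * (x ^ k * |x|)) x := by
  rcases eq_or_ne x 0 with rfl | hx
  · have h := hasDerivAt_zero_id_mul (g := fun x : ℝ => x ^ k * |x|) (by fun_prop)
    simp only [abs_zero, mul_zero] at h ⊢
    exact h.congr_of_eventuallyEq (Eventually.of_forall fun x => by ring)
  · have h := (hasDerivAt_pow (k + 1) x).mul (hasDerivAt_abs hx)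
    refine h.congr_deriv ?_
    have h2 : x * SignType.sign x = |x| := by
      rw [mul_comm]; exact sign_mul_self x
    push_cast
    rw [pow_succ, mul_assoc (x ^ k) x, h2]
    ring

theorem contDiff_pow_mul_abs (k : ℕ) : ContDiff ℝ k (fun x : ℝ => x ^ k * |x|) := by
  induction k with
  | zero => exact contDiff_zero.2 (by fun_prop)
  | succ k ih =>
    have hd := hasDerivAt_pow_succ_mul_abs k
    push_cast
    rw [contDiff_succ_iff_deriv]
    refine ⟨fun x => (hd x).differentiableAt, by simp, ?_⟩
    rw [funext fun x => (hd x).deriv]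
    exact contDiff_const.mul ih

/-- The derivative of `x ^ (k + 1) * |x|` is `(k + 2) * (x ^ k * |x|)`; descending along it leads to
the corner of `|x|`. -/
theorem not_contDiffAt_pow_mul_abs (k : ℕ) :
    ¬ ContDiffAt ℝ ((k + 1 : ℕ) : WithTop ℕ∞) (fun x : ℝ => x ^ k * |x|) 0 := by
  induction k with
  | zero =>
    intro h
    refine not_differentiableAt_abs_zero ?_
    simpa using h.differentiableAt (by simp)
  | succ k ih =>
    intro h
    refine ih ?_
    have h1 : ContDiffAt ℝ ((k + 1 : ℕ) : WithTop ℕ∞)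
        (fun x => (fderiv ℝ (fun x : ℝ => x ^ (k + 1) * |x|) x) 1) 0 :=
      (ContDiffAt.fderiv_right h (by norm_cast)).clm_apply contDiffAt_const
    have h2 := (contDiffAt_const (c := ((k : ℝ) + 2)⁻¹)).mul h1
    refine ContDiffAt.congr_of_eventuallyEq h2 (Eventually.of_forall fun x => ?_)
    have hk : (k : ℝ) + 2 ≠ 0 := by positivity
    simp only [fderiv_apply_one_eq_deriv, (hasDerivAt_pow_succ_mul_abs k x).deriv,
      inv_mul_cancel_left₀ hk]

/-- The map `(x, y) ↦ (x + x a(x), y + x b(x))` of the plane. -/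
noncomputable def planeTwist (a b : ℝ → ℝ) (v : Coord ℝ 2) : Coord ℝ 2 :=
  !₂[v 0 + v 0 * a (v 0), v 1 + v 0 * b (v 0)]

/-- The linear map `(x, y) ↦ ((1 + a) x, y + b x)` of the plane. -/
noncomputable def planeLinear (a b : ℝ) : Coord ℝ 2 →L[ℝ] Coord ℝ 2 :=
  LinearMap.toContinuousLinearMap
    { toFun := fun v => !₂[(1 + a) * v 0, v 1 + b * v 0]
      map_add' := fun v w => by ext i; fin_cases i <;> simp <;> ring
      map_smul' := fun c v => by ext i; fin_cases i <;> simp <;> ring }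

theorem planeLinear_apply (a b : ℝ) (v : Coord ℝ 2) :
    planeLinear a b v = !₂[(1 + a) * v 0, v 1 + b * v 0] := rfl

/-- An explicit Hadamard factorization, whose linear factor need only be as regular as `a` and `b`.
-/
theorem planeTwist_eq (a b : ℝ → ℝ) (v : Coord ℝ 2) :
    planeTwist a b v = planeLinear (a (v 0)) (b (v 0)) v := by
  rw [planeLinear_apply, planeTwist]
  congr 2
  · ring
  · congr 1; ring

theorem derivAt_planeTwist {a b : ℝ → ℝ} (ha : ContinuousAt a 0) (hb : ContinuousAt b 0) :
    derivAt ℝ 2 (planeTwist a b) 0 = planeLinear (a 0) (b 0) := by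
  have h1 := hasDerivAt_zero_id_mul ha
  have h2 := hasDerivAt_zero_id_mul hb
  have h3 : HasFDerivAt (planeTwist a b) (planeLinear (a 0) (b 0)) 0 := by
    rw [← hasFDerivWithinAt_univ, hasFDerivWithinAt_euclidean]
    simp only [hasFDerivWithinAt_univ]
    have e0 : HasFDerivAt (fun v : Coord ℝ 2 => v 0) (EuclideanSpace.proj (𝕜 := ℝ) 0) 0 :=
      (EuclideanSpace.proj (𝕜 := ℝ) (0 : Fin 2)).hasFDerivAt
    have e1 : HasFDerivAt (fun v : Coord ℝ 2 => v 1) (EuclideanSpace.proj (𝕜 := ℝ) 1) 0 :=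
      (EuclideanSpace.proj (𝕜 := ℝ) (1 : Fin 2)).hasFDerivAt
    intro i
    fin_cases i
    · refine (e0.add (h1.comp_hasFDerivAt (0 : Coord ℝ 2) (f := fun v => v 0) e0)).congr_fderiv ?_
      ext v
      simp [planeLinear_apply]; ring
    · refine (e1.add (h2.comp_hasFDerivAt (0 : Coord ℝ 2) (f := fun v => v 0) e0)).congr_fderiv ?_
      ext v
      simp [planeLinear_apply]
  rw [derivAt, mfderiv_eq_fderiv]
  exact h3.fderiv

theorem uncentred_self {n : ℕ} (v : Coord ℝ n) :
    uncentred ℝ n (0 : Coord ℝ n) v = v :=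
  zero_add v

theorem centred_self {n : ℕ} (v : Coord ℝ n) :
    centred ℝ n (0 : Coord ℝ n) v = v :=
  sub_zero v

theorem mem_excChart_target_self {n : ℕ} (i : Fin n) (u : Coord ℝ n) :
    u ∈ (excChart (𝕜 := ℝ) (0 : Coord ℝ n) i).target :=
  mem_univ _

/-- For `v = u_0 d` the first coordinate of `v` is `u_0`, so the linear factor depends on `u_0`
alone and the lift shows `a` and `b` without the smoothing factor `x`. -/
theorem excChart_planeTwist {a b : ℝ → ℝ} (ha : ContinuousAt a 0) (hb : ContinuousAt b 0)
    {h' : Blowup ℝ 2 (0 : Coord ℝ 2) → Blowup ℝ 2 (0 : Coord ℝ 2)}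
    (H : IsBlowupMap (planeTwist a b) h') {u : Coord ℝ 2} (hu : 1 + a (u 0) ≠ 0) :
    h' ((excChart 0 0).symm u) ∈ (excChart (𝕜 := ℝ) (0 : Coord ℝ 2) 0).source ∧
      excChart 0 0 (h' ((excChart 0 0).symm u)) =
        !₂[u 0 * (1 + a (u 0)), (u 1 + b (u 0)) / (1 + a (u 0))] := by
  have h1 : (u 0 • dir 0 u) 0 = u 0 := by simp
  obtain ⟨h2, h3⟩ := H.excChart_apply 0 0 (mem_excChart_target_self 0 u)
    (A := planeLinear (a (u 0)) (b (u 0))) (mem_univ _)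
    (by rw [centred_self, uncentred_self, planeTwist_eq, h1])
    (fun h0 => by rw [derivAt_planeTwist ha hb, h0])
    (by simpa [planeLinear_apply] using hu)
  refine ⟨h2, h3.trans ?_⟩
  ext i
  fin_cases i <;> simp [linearChange, planeLinear_apply]

theorem contDiff_planeTwist {m : WithTop ℕ∞} {a b : ℝ → ℝ}
    (ha : ContDiff ℝ m fun x => x * a x) (hb : ContDiff ℝ m fun x => x * b x) :
    ContDiff ℝ m (planeTwist a b) := by
  rw [contDiff_euclidean]
  have e0 : ContDiff ℝ m fun v : Coord ℝ 2 => v 0 := by fun_prop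
  have e1 : ContDiff ℝ m fun v : Coord ℝ 2 => v 1 := by fun_prop
  intro i
  fin_cases i
  · exact e0.add (ha.comp e0)
  · exact e1.add (hb.comp e0)

theorem blowupChart_exc_mem_maximalAtlas {n : ℕ} (i : Fin n) (m : WithTop ℕ∞) :
    blowupChart (excChart_mem_blowupAtlas (𝕜 := ℝ) (0 : Coord ℝ n) i) ∈
      IsManifold.maximalAtlas 𝓘(ℝ, Coord ℝ n) m (Blowup ℝ n (0 : Coord ℝ n)) :=
  IsManifold.subset_maximalAtlas (blowupChart_mem_atlas _)

/-- The shear `(x, y + x b(x))` lifts to `(u_0, u_1 + b(u_0))` in the chart `0`. For `b` with `x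
b(x)` of class `C^k` but `b` itself not, the lift fails to be `C^k` at the point `[1, 0]`. -/
theorem exists_blowup_not_contMDiffAt (k : ℕ) (hk : 1 ≤ k) :
    ∃ h : Aut ℝ 2 k (Coord ℝ 2) {0},
      ∀ h' : Blowup ℝ 2 (0 : Coord ℝ 2) → Blowup ℝ 2 (0 : Coord ℝ 2), IsBlowupMap h.1 h' →
        ∃ z ∈ exceptionalLocus ℝ 2 (0 : Coord ℝ 2),
          ¬ ContMDiffAt 𝓘(ℝ, Coord ℝ 2) 𝓘(ℝ, Coord ℝ 2) k h' z := by
  -- From here on the order in question is `k + 1`.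
  obtain ⟨k, rfl⟩ := Nat.exists_eq_add_of_le' hk
  set b : ℝ → ℝ := fun x => x ^ k * |x| with hb
  have hbc : Continuous b := by fun_prop
  have hb0 : ContDiff ℝ ((k + 1 : ℕ) : WithTop ℕ∞) fun x => x * b x := by
    have h : (fun x => x * b x) = fun x => x ^ (k + 1) * |x| := by
      ext x; simp only [hb]; ring
    rw [h]
    exact contDiff_pow_mul_abs (k + 1)
  have h00 : ContDiff ℝ ((k + 1 : ℕ) : WithTop ℕ∞) fun x : ℝ => x * (0 : ℝ → ℝ) x := by
    simpa using contDiff_const (c := (0 : ℝ))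
  let f : Coord ℝ 2 ≃ₜ Coord ℝ 2 :=
    { toFun := planeTwist 0 b
      invFun := planeTwist 0 (-b)
      left_inv := fun v => by ext i; fin_cases i <;> simp [planeTwist]
      right_inv := fun v => by ext i; fin_cases i <;> simp [planeTwist]
      continuous_toFun := (contDiff_planeTwist h00 hb0).continuous
      continuous_invFun := (contDiff_planeTwist h00
        (by simpa using hb0.neg)).continuous }
  have hf0 : f 0 = 0 := by
    change planeTwist 0 b 0 = 0
    ext i; fin_cases i <;> simp [planeTwist]
  refine ⟨⟨f, (contDiff_planeTwist h00 hb0).contMDiff,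
    (contDiff_planeTwist h00 (by simpa using hb0.neg)).contMDiff,
    by rw [image_singleton, hf0]⟩, fun h' H => ?_⟩
  have H' : IsBlowupMap (planeTwist 0 b) h' := H
  have hchart : ∀ u : Coord ℝ 2, h' ((excChart 0 0).symm u) ∈
      (excChart (𝕜 := ℝ) (0 : Coord ℝ 2) 0).source ∧
      excChart 0 0 (h' ((excChart 0 0).symm u)) = !₂[u 0, u 1 + b (u 0)] := fun u => by
    have := excChart_planeTwist (a := 0) continuousAt_const hbc.continuousAt H' (u := u) (by simp)
    simpa using this
  have ht := mem_excChart_target_self (0 : Fin 2) 0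
  refine ⟨(excChart 0 0).symm 0, ?_, fun hc => ?_⟩
  · change blowdown _ = _
    rw [blowdown_excChart_symm]
    simp [uncentred_zero]
  · have h1 := ((contMDiffAt_iff_of_mem_maximalAtlas
      (e := blowupChart (excChart_mem_blowupAtlas (0 : Coord ℝ 2) 0))
      (e' := blowupChart (excChart_mem_blowupAtlas (0 : Coord ℝ 2) 0))
      (blowupChart_exc_mem_maximalAtlas 0 _) (blowupChart_exc_mem_maximalAtlas 0 _)
      ((excChart 0 0).map_target ht) (hchart 0).1).1 hc).2
    rw [ModelWithCorners.range_eq_univ, contDiffWithinAt_univ] at h1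
    have h2 : ContDiffAt ℝ ((k + 1 : ℕ) : WithTop ℕ∞)
        (fun u : Coord ℝ 2 => (!₂[u 0, u 1 + b (u 0)] : Coord ℝ 2)) 0 := by
      have h3 : (blowupChart (excChart_mem_blowupAtlas (𝕜 := ℝ) (0 : Coord ℝ 2) 0)).extend
          𝓘(ℝ, Coord ℝ 2) ((excChart 0 0).symm 0) = 0 := (excChart 0 0).right_inv ht
      rw [h3] at h1
      exact h1.congr_of_eventuallyEq (Eventually.of_forall fun u => (hchart u).2.symm)
    -- Restricting to the line `u_1 = 0` isolates `b` as the second coordinate.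
    have h4 : ContDiffAt ℝ ((k + 1 : ℕ) : WithTop ℕ∞)
        (fun x : ℝ => (!₂[x, 0] : Coord ℝ 2)) 0 := by
      rw [contDiffAt_euclidean]
      intro i
      fin_cases i
      · exact contDiffAt_id
      · exact contDiffAt_const
    have h5 : (!₂[(0 : ℝ), 0] : Coord ℝ 2) = 0 := by ext i; fin_cases i <;> simp
    rw [← h5] at h2
    have h6 := contDiffAt_euclidean.1 (ContDiffAt.comp (0 : ℝ) h2 h4) 1
    exact not_contDiffAt_pow_mul_abs k (by simpa [Function.comp_def] using h6)

theorem hasDerivAt_add_mul_abs (x : ℝ) : HasDerivAt (fun x : ℝ => x + x * |x|) (1 + 2 * |x|) x := by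
  simpa [Pi.add_def] using (hasDerivAt_id x).add (hasDerivAt_pow_succ_mul_abs 0 x)

theorem contDiff_add_mul_abs : ContDiff ℝ 1 fun x : ℝ => x + x * |x| := by
  simpa using contDiff_id.add (contDiff_pow_mul_abs 1)

/-- The homeomorphism `x ↦ x + x|x|` of the line. -/
noncomputable def addMulAbsHomeomorph : ℝ ≃ₜ ℝ :=
  (StrictMono.orderIsoOfSurjective (fun x : ℝ => x + x * |x|)
    (strictMono_of_deriv_pos fun x => by rw [(hasDerivAt_add_mul_abs x).deriv]; positivity)
    (fun y => mem_range_of_exists_le_of_exists_ge contDiff_add_mul_abs.continuous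
      ⟨-|y|, by
        rw [abs_neg, abs_abs]
        nlinarith [neg_abs_le y, abs_nonneg y]⟩
      ⟨|y|, by
        rw [abs_abs]
        nlinarith [le_abs_self y, abs_nonneg y]⟩)).toHomeomorph

theorem contDiff_addMulAbsHomeomorph_symm : ContDiff ℝ 1 addMulAbsHomeomorph.symm :=
  addMulAbsHomeomorph.contDiff_symm_deriv (f' := fun x => 1 + 2 * |x|)
    (fun x => by positivity) hasDerivAt_add_mul_abs contDiff_add_mul_abs

/-- In the chart `0` the lift is `(u_0 (1 + |u_0|), u_1 / (1 + |u_0|))`, and the curve is the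
vertical-slope line `t ↦ (t, m)` of that chart, which blows down to `(t, m t)`. Its image has second
coordinate `m / (1 + |t|)`, with a corner at `0`. -/
theorem exists_blowup_not_mdifferentiableAt :
    ∃ h : Aut ℝ 2 1 (Coord ℝ 2) {0},
      (∀ v : Coord ℝ 2, h.1 v = !₂[v 0 + v 0 * |v 0|, v 1]) ∧
      ∀ h' : Blowup ℝ 2 (0 : Coord ℝ 2) → Blowup ℝ 2 (0 : Coord ℝ 2), IsBlowupMap h.1 h' →
        ∀ m : ℝ, m ≠ 0 →
          ∃ c : ℝ → Blowup ℝ 2 (0 : Coord ℝ 2),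
            (∀ t, blowdown (c t) = !₂[t, m * t]) ∧
            (∃ hv : (!₂[1, m] : Coord ℝ 2) ≠ 0,
              c 0 = Blowup.exc (Projectivization.mk ℝ !₂[1, m] hv)) ∧
            ContMDiff 𝓘(ℝ, ℝ) 𝓘(ℝ, Coord ℝ 2) ∞ c ∧
            Continuous (h' ∘ c) ∧
            ¬ MDifferentiableAt 𝓘(ℝ, ℝ) 𝓘(ℝ, Coord ℝ 2) (h' ∘ c) 0 ∧
            ¬ MDifferentiableAt 𝓘(ℝ, Coord ℝ 2) 𝓘(ℝ, Coord ℝ 2) h' (c 0) := by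
  have habs : ContDiff ℝ 1 fun x : ℝ => x * |x| := by simpa using contDiff_pow_mul_abs 1
  have h00 : ContDiff ℝ 1 fun x : ℝ => x * (0 : ℝ → ℝ) x := by
    simpa using contDiff_const (c := (0 : ℝ))
  set g := addMulAbsHomeomorph
  have hf : ContDiff ℝ 1 (planeTwist (fun x => |x|) 0) := contDiff_planeTwist habs h00
  have hfi : ContDiff ℝ 1 (fun v : Coord ℝ 2 => (!₂[g.symm (v 0), v 1] : Coord ℝ 2)) := by
    rw [contDiff_euclidean]
    intro i
    fin_cases i
    · exact contDiff_addMulAbsHomeomorph_symm.comp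
        (show ContDiff ℝ 1 fun v : Coord ℝ 2 => v 0 by fun_prop)
    · exact show ContDiff ℝ 1 fun v : Coord ℝ 2 => v 1 by fun_prop
  let f : Coord ℝ 2 ≃ₜ Coord ℝ 2 :=
    { toFun := planeTwist (fun x => |x|) 0
      invFun := fun v => !₂[g.symm (v 0), v 1]
      left_inv := fun v => by
        ext i
        fin_cases i
        · exact g.symm_apply_apply (v 0)
        · simp [planeTwist]
      right_inv := fun v => by
        ext i
        fin_cases i
        · exact g.apply_symm_apply (v 0)
        · simp [planeTwist]
      continuous_toFun := hf.continuous
      continuous_invFun := hfi.continuous }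
  have hfv : ∀ v, f v = !₂[v 0 + v 0 * |v 0|, v 1] := fun v => by
    change planeTwist (fun x => |x|) 0 v = _
    simp [planeTwist]
  have hf0 : f 0 = 0 := by
    rw [hfv]
    ext i; fin_cases i <;> simp
  refine ⟨⟨f, hf.contMDiff, hfi.contMDiff, by rw [image_singleton, hf0]⟩, hfv,
    fun h' H m hm => ?_⟩
  have H' : IsBlowupMap (planeTwist (fun x => |x|) 0) h' := H
  have hne : ∀ t : ℝ, 1 + |t| ≠ 0 := fun t => by positivity
  set E := blowupChart (excChart_mem_blowupAtlas (𝕜 := ℝ) (0 : Coord ℝ 2) (0 : Fin 2))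
  have hEt : ∀ u, u ∈ E.target := mem_excChart_target_self 0
  have hE : ∀ r : WithTop ℕ∞, E ∈ IsManifold.maximalAtlas 𝓘(ℝ, Coord ℝ 2) r
    (Blowup ℝ 2 (0 : Coord ℝ 2)) := blowupChart_exc_mem_maximalAtlas 0
  have hchart : ∀ u : Coord ℝ 2, h' (E.symm u) ∈ E.source ∧
      E (h' (E.symm u)) = !₂[u 0 * (1 + |u 0|), u 1 / (1 + |u 0|)] := fun u => by
    have := excChart_planeTwist (a := fun x => |x|) (b := 0) (by fun_prop) continuousAt_const H'
      (u := u) (hne _)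
    simp only [Pi.zero_apply, add_zero] at this
    exact this
  have hγ : ContDiff ℝ ∞ fun t : ℝ => (!₂[t, m] : Coord ℝ 2) := by
    rw [contDiff_euclidean]
    intro i
    fin_cases i
    · exact contDiff_id
    · exact contDiff_const
  have hc : ContMDiff 𝓘(ℝ, ℝ) 𝓘(ℝ, Coord ℝ 2) ∞ fun t : ℝ => E.symm !₂[t, m] := fun t =>
    ContMDiffAt.comp t (contMDiffAt_symm_of_mem_maximalAtlas (hE ∞) (hEt _))
      hγ.contMDiff.contMDiffAt
  have hcomp : ∀ t : ℝ, h' (E.symm !₂[t, m]) = E.symm !₂[t * (1 + |t|), m / (1 + |t|)] := by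
    intro t
    obtain ⟨h1, h2⟩ := hchart !₂[t, m]
    rw [← E.left_inv h1, h2]
    rfl
  have hnd : ¬ MDifferentiableAt 𝓘(ℝ, ℝ) 𝓘(ℝ, Coord ℝ 2) (h' ∘ fun t : ℝ => E.symm !₂[t, m]) 0 := by
    intro hd
    have h1 : MDifferentiableAt 𝓘(ℝ, Coord ℝ 2) 𝓘(ℝ, Coord ℝ 2) E
        ((h' ∘ fun t : ℝ => E.symm !₂[t, m]) 0) :=
      (contMDiffAt_of_mem_maximalAtlas (hE 1) (hchart !₂[0, m]).1).mdifferentiableAt (by simp)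
    have h2 := (h1.comp (0 : ℝ) hd).differentiableAt
    have h3 := differentiableAt_euclidean.1 h2 1
    have h4 : DifferentiableAt ℝ (fun t : ℝ => m / (1 + |t|)) 0 := by
      refine h3.congr_of_eventuallyEq (Eventually.of_forall fun t => ?_)
      have := (hchart !₂[t, m]).2
      simp only [Function.comp_apply, this]
      rfl
    refine not_differentiableAt_abs_zero ?_
    -- Dividing `m` by `m / (1 + |t|)` and subtracting `1` recovers `|t|`; this is where `m ≠ 0`
    -- enters.
    have h5 := ((differentiableAt_const m (x := (0 : ℝ))).div h4 (by simpa using hm)).sub_const 1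
    refine h5.congr_of_eventuallyEq (Eventually.of_forall fun t => ?_)
    have := hne t
    simp only [Pi.div_apply]
    field_simp
    ring
  refine ⟨fun t => E.symm !₂[t, m], fun t => ?_, ?_, hc, ?_, hnd, fun hd => hnd ?_⟩
  · refine (blowdown_excChart_symm _ _ _).trans ((uncentred_self _).trans ?_)
    ext i
    fin_cases i <;> simp [mul_comm]
  · have h1 : dir (0 : Fin 2) (!₂[0, m] : Coord ℝ 2) = !₂[1, m] := by
      ext i; fin_cases i <;> simp
    have h2 : (!₂[1, m] : Coord ℝ 2) ≠ 0 := h1 ▸ dir_ne_zero _ _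
    exact ⟨h2, (excChart_symm_of_zero (by simp)).trans (exc_mk_congr h1 _ _)⟩
  · have h1 : Continuous fun t : ℝ => (!₂[t * (1 + |t|), m / (1 + |t|)] : Coord ℝ 2) := by
      refine (PiLp.continuous_toLp 2 _).comp (continuous_pi fun i => ?_)
      fin_cases i
      · exact show Continuous fun t : ℝ => t * (1 + |t|) by fun_prop
      · exact continuous_const.div (by fun_prop) hne
    have h2 : h' ∘ (fun t : ℝ => E.symm !₂[t, m]) =
        fun t => E.symm !₂[t * (1 + |t|), m / (1 + |t|)] := funext hcomp
    rw [h2]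
    exact continuous_iff_continuousAt.2 fun t =>
      (E.continuousAt_symm (hEt _)).comp h1.continuousAt
  · exact hd.comp (0 : ℝ) ((hc 0).mdifferentiableAt (by simp))

end Examples

end ClassicalBlowup

/-! ### The main theorem -/

theorem mainTheorem1 :
    -- real case
    (∀ (n : ℕ) (M : Type*) [TopologicalSpace M] [T2Space M]
      [ChartedSpace (ClassicalBlowup.Coord ℝ n) M]
      [IsManifold 𝓘(ℝ, ClassicalBlowup.Coord ℝ n) ∞ M] (p : M) (k : ℕ∞), 1 ≤ k →
      ∃ β : ClassicalBlowup.Aut ℝ n k M {p} →*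
          ClassicalBlowup.Aut ℝ n ((k - 1 : ℕ∞) : WithTop ℕ∞) (ClassicalBlowup.Blowup ℝ n p)
            (ClassicalBlowup.exceptionalLocus ℝ n p),
        (∀ h, ClassicalBlowup.IsBlowupMap (𝕜 := ℝ) (n := n) (p := p) h.1 (β h).1) ∧
        Function.Injective β ∧
        Continuous[ClassicalBlowup.weakTopology ℝ n k M {p},
          ClassicalBlowup.weakTopology ℝ n ((k - 1 : ℕ∞) : WithTop ℕ∞)
            (ClassicalBlowup.Blowup ℝ n p) (ClassicalBlowup.exceptionalLocus ℝ n p)] β ∧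
        ∀ h, ∀ z ∉ ClassicalBlowup.exceptionalLocus ℝ n p,
          ContMDiffAt 𝓘(ℝ, ClassicalBlowup.Coord ℝ n) 𝓘(ℝ, ClassicalBlowup.Coord ℝ n) k
            (β h).1 z) ∧
    -- complex analytic case
    (∀ (n : ℕ) (M : Type*) [TopologicalSpace M] [T2Space M]
      [ChartedSpace (ClassicalBlowup.Coord ℂ n) M]
      [IsManifold 𝓘(ℂ, ClassicalBlowup.Coord ℂ n) ω M] (p : M),
      ∃ β : ClassicalBlowup.Aut ℂ n ω M {p} →*
          ClassicalBlowup.Aut ℂ n ω (ClassicalBlowup.Blowup ℂ n p)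
            (ClassicalBlowup.exceptionalLocus ℂ n p),
        (∀ h, ClassicalBlowup.IsBlowupMap (𝕜 := ℂ) (n := n) (p := p) h.1 (β h).1) ∧
        Function.Injective β ∧
        Continuous[ClassicalBlowup.compactOpenTopology ℂ n ω M {p},
          ClassicalBlowup.compactOpenTopology ℂ n ω
            (ClassicalBlowup.Blowup ℂ n p) (ClassicalBlowup.exceptionalLocus ℂ n p)] β) ∧
    -- for every finite `k ≥ 1` the loss of one derivative along the exceptional locus does occur
    (∀ k : ℕ, 1 ≤ k → ∃ h : ClassicalBlowup.Aut ℝ 2 k (ClassicalBlowup.Coord ℝ 2) {0},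
      ∀ h' : ClassicalBlowup.Blowup ℝ 2 (0 : ClassicalBlowup.Coord ℝ 2) →
          ClassicalBlowup.Blowup ℝ 2 (0 : ClassicalBlowup.Coord ℝ 2),
        ClassicalBlowup.IsBlowupMap h.1 h' →
        ∃ z ∈ ClassicalBlowup.exceptionalLocus ℝ 2 (0 : ClassicalBlowup.Coord ℝ 2),
          ¬ ContMDiffAt 𝓘(ℝ, ClassicalBlowup.Coord ℝ 2) 𝓘(ℝ, ClassicalBlowup.Coord ℝ 2) k h' z) ∧
    -- the explicit example for `k = 1`
    (∃ h : ClassicalBlowup.Aut ℝ 2 1 (ClassicalBlowup.Coord ℝ 2) {0},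
      (∀ v : ClassicalBlowup.Coord ℝ 2, h.1 v = !₂[v 0 + v 0 * |v 0|, v 1]) ∧
      ∀ h' : ClassicalBlowup.Blowup ℝ 2 (0 : ClassicalBlowup.Coord ℝ 2) →
          ClassicalBlowup.Blowup ℝ 2 (0 : ClassicalBlowup.Coord ℝ 2),
        ClassicalBlowup.IsBlowupMap h.1 h' →
        ∀ m : ℝ, m ≠ 0 →
          ∃ c : ℝ → ClassicalBlowup.Blowup ℝ 2 (0 : ClassicalBlowup.Coord ℝ 2),
            (∀ t, ClassicalBlowup.blowdown (c t) = !₂[t, m * t]) ∧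
            (∃ hv : (!₂[1, m] : ClassicalBlowup.Coord ℝ 2) ≠ 0,
              c 0 = ClassicalBlowup.Blowup.exc (Projectivization.mk ℝ !₂[1, m] hv)) ∧
            ContMDiff 𝓘(ℝ, ℝ) 𝓘(ℝ, ClassicalBlowup.Coord ℝ 2) ∞ c ∧
            Continuous (h' ∘ c) ∧
            ¬ MDifferentiableAt 𝓘(ℝ, ℝ) 𝓘(ℝ, ClassicalBlowup.Coord ℝ 2) (h' ∘ c) 0 ∧
            ¬ MDifferentiableAt 𝓘(ℝ, ClassicalBlowup.Coord ℝ 2)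
              𝓘(ℝ, ClassicalBlowup.Coord ℝ 2) h' (c 0)) := by
  refine ⟨fun n M _ _ _ _ p k hk => ?_, fun n M _ _ _ _ p => ?_, ?_, ?_⟩
  · exact ClassicalBlowup.exists_blowupHom_weakTopology p hk
  · exact ClassicalBlowup.exists_blowupHom_compactOpenTopology p
  · exact ClassicalBlowup.exists_blowup_not_contMDiffAt
  · exact ClassicalBlowup.exists_blowup_not_mdifferentiableAt
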